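/- Let $R$ be an artin algebra, i.e. an algebra over a commutative artinian ring $k$ that is finitely generated as a $k$-module. Let $\mathrm{mod}\,R$ be the category of finitely generated left $R$-modules, $\mathcal D=\mathcal D^b(\mathrm{mod}\,R)$ its bounded derived category (cochain complexes), and $\mathcal K^b(\mathcal P_R)$ the full subcategory of $\mathcal D$ of objects isomorphic to bounded complexes of finitely generated projective modules; objects of $\mathcal K^b(\mathcal P_R)$ are called compact. For integers $a,b$ let $\mathcal D^{[a,b]}$ be the class of complexes whose cohomology is concentrated in degrees in $[a,b]$, and for $T\in\mathcal D$ let $\mathrm{add}_{\mathcal D}T$ be the class of direct summands of finite direct sums of copies of $T$, and ${}^{\perp_{k>0}}T=\{X\in\mathcal D\mid \mathrm{Hom}_{\mathcal D}(X,T[k])=0 \text{ for all } k>0\}$. A complex $T\in\mathcal D$ is semi-selforthogonal if $\mathrm{Hom}_{\mathcal D}(T,T[k])=0$ for all $k>0$. It is silting if $T\in\mathcal K^b(\mathcal P_R)$, $T$ is semi-selforthogonal, and $T$ generates $\mathcal K^b(\mathcal P_R)$, i.e. $\mathcal K^b(\mathcal P_R)$ is the smallest triangulated subcategory closed under direct summands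 that contains $T$. For a finite interval $[a,b]$ with $T\in\mathcal D^{[a,b]}$, let $\mathcal X_T^{[a,b]}$ be the class of all $X$ for which there are triangles $X_i\to T_i\to X_{i+1}\to X_i[1]$ for all $i\ge 0$, with $X_0=X$, all $T_i\in\mathrm{add}_{\mathcal D}T$ and all $X_i\in{}^{\perp_{k>0}}T\cap\mathcal D^{[a,b]}$; let $\mathcal X_T^{\flat}$ be the union of these classes over all such intervals. $T$ is Wakamatsu-silting if it is semi-selforthogonal and the regular module $R$ (in degree $0$) is isomorphic to $X[n]$ for some $X\in\mathcal X_T^{\flat}$ and some $n\ge 0$. $R$ satisfies the finitistic dimension conjecture if there is an integer $n\geq 0$ such that every $M\in\mathrm{mod}\,R$ of finite projective dimension has projective dimension at most $n$. $R$ is an Igusa–Todorov algebra if for some $n\ge 0$ there is $V\in\mathrm{mod}\,R$ such that for every $M\in\mathrm{mod}\,R$ there is an exact sequence $0\to V_1\to V_0\to \Omega^nM\oplus P\to 0$ with $V_0,V_1\in\mathrm{add}\,V$ and $P$ finitely generated projective, where $\Omega^n M$ is an $n$-th syzygy of $M$. Theorem. (i) If the injective dimension of ${}_RR$ is finite, then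 $R$ satisfies the finitistic dimension conjecture. (ii) If $R$ is an Igusa–Todorov algebra, then $R$ satisfies the finitistic dimension conjecture. (iii) If $R$ satisfies the finitistic dimension conjecture, then every compact Wakamatsu-silting complex over $R$ is silting. -/

import Mathlib

open CategoryTheory CategoryTheory.Limits CategoryTheory.Pretriangulated

universe w v u

/-- A ring `R` is an artin algebra if it is an algebra, finitely generated as a module, over some
commutative artinian ring `k`. (There is no loss in taking `k` in the universe of `R`, since `k`
may be replaced by its image in `R`.) -/
class IsArtinAlgebra (R : Type u) [Ring R] : Prop where
  exists_base : ∃ (k : Type u) (_ : CommRing k) (_ : IsArtinianRing k) (_ : Algebra k R),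
    Module.Finite k R

/-- An artin algebra is left noetherian; this makes `FGModuleCat R` (the category `mod R` of
finitely generated left `R`-modules) abelian. -/
instance IsArtinAlgebra.isNoetherianRing (R : Type u) [Ring R] [h : IsArtinAlgebra R] :
    IsNoetherianRing R := by
  obtain ⟨k, _, _, _, _⟩ := h.exists_base
  exact isNoetherian_of_tower k (isNoetherian_of_isNoetherianRing_of_finite k R)

namespace WakamatsuSilting

noncomputable section

/-- `add M`: the direct summands (retracts) of finite direct sums of copies of `M`. -/
def addClosure {C : Type u} [Category.{v} C] [Preadditive C] [HasFiniteBiproducts C] (M : C) :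
    ObjectProperty C :=
  fun X => ∃ n : ℕ, Nonempty (Retract X (⨁ fun _ : Fin n => M))

section Modules

variable (R : Type u) [Ring R]

/-- The finitistic dimension conjecture holds for `R`: the projective dimensions of the finitely
generated left `R`-modules of finite projective dimension are bounded. -/
def FinitisticDimensionConjecture : Prop :=
  ∃ n : ℕ, ∀ M : FGModuleCat.{u} R,
    projectiveDimension M.obj ≠ ⊤ → projectiveDimension M.obj ≤ n

variable [IsNoetherianRing R]

instance : HasFiniteBiproducts (FGModuleCat.{u} R) :=
  Abelian.hasFiniteBiproducts

/-- `IsSyzygy R n M K`: there is an exact sequence `0 → K → Pₙ₋₁ → ⋯ → P₀ → M → 0` with all `Pᵢ`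
finitely generated projective (the resolution need not be minimal). -/
def IsSyzygy : ℕ → FGModuleCat.{u} R → FGModuleCat.{u} R → Prop
  | 0, M, K => Nonempty (K ≅ M)
  | n + 1, M, K => ∃ S : ShortComplex (FGModuleCat.{u} R), S.ShortExact ∧
      Module.Projective R S.X₂ ∧ Nonempty (S.X₃ ≅ M) ∧ IsSyzygy n S.X₁ K

/-- `R` is an Igusa–Todorov algebra: for some `n` there is a finitely generated module `V` such
that every finitely generated module `M` admits an exact sequence
`0 → V₁ → V₀ → Ωⁿ M ⊕ P → 0` with `V₁, V₀ ∈ add V` and `P` finitely generated projective. -/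
def IsIgusaTodorov : Prop :=
  ∃ (n : ℕ) (V : FGModuleCat.{u} R), ∀ M : FGModuleCat.{u} R,
    ∃ (K P : FGModuleCat.{u} R) (S : ShortComplex (FGModuleCat.{u} R)),
      IsSyzygy R n M K ∧ Module.Projective R P ∧ S.ShortExact ∧
      addClosure V S.X₁ ∧ addClosure V S.X₂ ∧ Nonempty (S.X₃ ≅ K ⊞ P)

end Modules

section Derived

variable {R : Type u} [Ring R] [IsNoetherianRing R] [HasDerivedCategory.{w} (FGModuleCat.{u} R)]

/-- `D^[a,b](mod R)`: the complexes whose cohomology is concentrated in degrees in `[a,b]`. -/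
def inInterval (a b : ℤ) : ObjectProperty (DerivedCategory (FGModuleCat.{u} R)) :=
  fun X => X.IsGE a ∧ X.IsLE b

variable (R) in
/-- The objects of `K^b(P_R)`, as objects of the derived category: those isomorphic to a bounded
complex of finitely generated projective modules. -/
def perfect : ObjectProperty (DerivedCategory (FGModuleCat.{u} R)) :=
  fun X => ∃ P : CochainComplex (FGModuleCat.{u} R) ℤ,
    (∃ a b : ℤ, P.IsStrictlyGE a ∧ P.IsStrictlyLE b) ∧
    (∀ i : ℤ, Module.Projective R (P.X i)) ∧
    Nonempty (X ≅ DerivedCategory.Q.obj P)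

/-- `^{⊥_{k>0}} M`: the objects `X` with `Hom(X, M[k]) = 0` for all `k > 0`. -/
def leftPerp (M : DerivedCategory (FGModuleCat.{u} R)) :
    ObjectProperty (DerivedCategory (FGModuleCat.{u} R)) :=
  fun X => ∀ k : ℤ, 0 < k → ∀ f : X ⟶ M⟦k⟧, f = 0

/-- `M` is semi-selforthogonal: `Hom(M, M[k]) = 0` for all `k > 0`. -/
def IsSemiSelfOrthogonal (M : DerivedCategory (FGModuleCat.{u} R)) : Prop :=
  leftPerp M M

/-- `𝒳_M^[a,b]`: the objects `X` for which there are triangles `Xᵢ → Mᵢ → Xᵢ₊₁ →` for all `i ≥ 0`,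
with `X₀ = X`, all `Mᵢ ∈ add M` and all `Xᵢ ∈ ^{⊥_{k>0}} M ∩ D^[a,b](mod R)`. -/
def coAuslanderInterval (M : DerivedCategory (FGModuleCat.{u} R)) (a b : ℤ) :
    ObjectProperty (DerivedCategory (FGModuleCat.{u} R)) :=
  fun X => ∃ Y N : ℕ → DerivedCategory (FGModuleCat.{u} R),
    Nonempty (Y 0 ≅ X) ∧
    ∀ i : ℕ, leftPerp M (Y i) ∧ inInterval a b (Y i) ∧ addClosure M (N i) ∧
      ∃ (f : Y i ⟶ N i) (g : N i ⟶ Y (i + 1)) (h : Y (i + 1) ⟶ (Y i)⟦(1 : ℤ)⟧),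
        Triangle.mk f g h ∈ distTriang (DerivedCategory (FGModuleCat.{u} R))

/-- The co-Auslander class `𝒳_M^♭`: the union of the `𝒳_M^[a,b]` over the finite intervals
`[a,b]` with `M ∈ D^[a,b](mod R)`. -/
def coAuslander (M : DerivedCategory (FGModuleCat.{u} R)) :
    ObjectProperty (DerivedCategory (FGModuleCat.{u} R)) :=
  fun X => ∃ a b : ℤ, inInterval a b M ∧ coAuslanderInterval M a b X

/-- `⟨𝒞⟩₊`: the objects `C[n]` with `C ∈ 𝒞` and `n ≥ 0`. -/
def shiftPlus (𝒞 : ObjectProperty (DerivedCategory (FGModuleCat.{u} R))) :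
    ObjectProperty (DerivedCategory (FGModuleCat.{u} R)) :=
  fun X => ∃ (Y : DerivedCategory (FGModuleCat.{u} R)) (n : ℕ),
    𝒞 Y ∧ Nonempty (X ≅ Y⟦(n : ℤ)⟧)

variable (R) in
/-- The regular module `_R R`, as a complex concentrated in degree `0`. -/
def regular : DerivedCategory (FGModuleCat.{u} R) :=
  (DerivedCategory.singleFunctor (FGModuleCat.{u} R) 0).obj (FGModuleCat.of R R)

/-- `T` is a Wakamatsu-silting complex: `T ∈ D^b(mod R)` is semi-selforthogonal and
`R ∈ ⟨𝒳_T^♭⟩₊`. -/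
structure IsWakamatsuSilting (T : DerivedCategory (FGModuleCat.{u} R)) : Prop where
  bounded : DerivedCategory.TStructure.t.bounded T
  semiSelfOrthogonal : IsSemiSelfOrthogonal T
  regular_mem : shiftPlus (coAuslander T) (regular R)

/-- `T` is a silting complex: `T ∈ K^b(P_R)` is semi-selforthogonal and generates `K^b(P_R)`, that
is, `K^b(P_R)` is the smallest triangulated subcategory closed under direct summands that
contains `T`. -/
structure IsSilting (T : DerivedCategory (FGModuleCat.{u} R)) : Prop where
  perfect_mem : perfect R T
  semiSelfOrthogonal : IsSemiSelfOrthogonal T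
  generates : (ObjectProperty.singleton T).triangEnvelope = perfect R

end Derived

end

end WakamatsuSilting

/-! The three statements rest on different mechanisms.

(i) If `R` has finite injective dimension `n`, free modules have no `Ext^i` into them for `i > n`.
For `M` of finite projective dimension, the top nonvanishing `Ext(M, -)` is right exact, so it is
already detected on free modules. Hence the projective dimension of `M` is at most `n`.

(ii) By dimension shifting it suffices to bound the finite projective dimensions of cokernels `X₃`
of monomorphisms `X₁ ⟶ X₂` in `add V` (`exists_hasProjectiveDimensionLT_of_addClosure`). If `X₃` has
finite projective dimension, high syzygies of `X₁` and `X₂` are stably isomorphic. The classes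
involved lie in a finitely generated submonoid of the cancellative monoid of stable classes, so a
Noetherian argument for the syzygy operator makes `n`-th syzygies stably isomorphic, with `n`
depending only on `V`. Composing the induced map with such an isomorphism gives an endomorphism of
the `n`-th syzygy of `X₁`. Fitting's lemma splits it as an automorphism plus a nilpotent part. The
nilpotent part lives on a summand of finite projective dimension, and only finitely many
nonprojective indecomposables can occur there, which yields the bound.

(iii) Finite finitistic dimension passes to complexes: a perfect complex with cohomology in degrees
`≥ a` has projective amplitude starting at `a - d`, with `d` independent of the complex
(`projGE_of_finitisticDimension`). In a coresolution of a shift of `R` by `add T`, all cosyzygies `Y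
i` are perfect with cohomology in one interval, so the bound is uniform. Dimension shifting embeds
`Hom(Y (m+1), (Y m)[1])` into `Hom(Y (m+1), (Y 0)[m+1])`, which vanishes for large `m`. The
coresolution therefore splits at a finite stage, and `R` lies in the thick subcategory generated by
`T`. -/

namespace FGModuleCat

variable {R : Type u} [Ring R] [IsNoetherianRing R]

/-! ### Projectivity and projective dimension in `mod R` and in `Mod R` -/

instance forget₂_additive : (forget₂ (FGModuleCat.{u} R) (ModuleCat.{u} R)).Additive where

lemma epi_iff_surjective {M N : FGModuleCat.{u} R} (f : M ⟶ N) :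
    Epi f ↔ Function.Surjective f.hom.hom := by
  rw [← ModuleCat.epi_iff_surjective]
  refine ⟨fun _ ↦ inferInstanceAs (Epi ((forget₂ _ (ModuleCat.{u} R)).map f)), fun h ↦ ?_⟩
  have : Epi ((forget₂ (FGModuleCat.{u} R) (ModuleCat.{u} R)).map f) := h
  exact (forget₂ _ (ModuleCat.{u} R)).epi_of_epi_map this

lemma projective_of_module_projective (M : FGModuleCat.{u} R) [Module.Projective R M] :
    Projective M where
  factors {E X} f e he := by
    obtain ⟨g, hg⟩ := Module.projective_lifting_property e.hom.hom f.hom.hom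
      ((epi_iff_surjective e).1 he)
    exact ⟨ofHom g, by ext x; exact LinearMap.congr_fun hg x⟩

lemma exists_free_epi (M : FGModuleCat.{u} R) :
    ∃ (n : ℕ) (f : of R (Fin n → R) ⟶ M), Epi f := by
  obtain ⟨n, f, hf⟩ := Module.Finite.exists_fin' R M
  exact ⟨n, ofHom f, (epi_iff_surjective _).2 hf⟩

instance enoughProjectives : EnoughProjectives (FGModuleCat.{u} R) where
  presentation M := by
    obtain ⟨n, f, hf⟩ := exists_free_epi M
    exact ⟨{ p := of R (Fin n → R), projective := projective_of_module_projective _, f := f }⟩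

lemma projective_iff (M : FGModuleCat.{u} R) : Projective M ↔ Module.Projective R M := by
  refine ⟨fun _ ↦ ?_, fun _ ↦ projective_of_module_projective M⟩
  obtain ⟨n, f, hf⟩ := exists_free_epi M
  refine Module.Projective.of_split (M := Fin n → R) (Projective.factorThru (𝟙 M) f).hom.hom
    f.hom.hom ?_
  rw [← hom_hom_comp, Projective.factorThru_comp]
  rfl

lemma projective_obj_iff (M : FGModuleCat.{u} R) : Projective M.obj ↔ Projective M := by
  rw [projective_iff]
  exact (IsProjective.iff_projective (R := R) M).symm

lemma hasProjectiveDimensionLT_obj_iff (M : FGModuleCat.{u} R) (n : ℕ) :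
    HasProjectiveDimensionLT M.obj n ↔ HasProjectiveDimensionLT M n := by
  match n with
  | 0 =>
    rw [hasProjectiveDimensionLT_zero_iff_isZero, hasProjectiveDimensionLT_zero_iff_isZero]
    refine ⟨fun h ↦ ?_, fun h ↦ (forget₂ _ (ModuleCat.{u} R)).map_isZero h⟩
    rw [IsZero.iff_id_eq_zero] at h ⊢
    exact (forget₂ _ (ModuleCat.{u} R)).map_injective h
  | 1 =>
    rw [← projective_iff_hasProjectiveDimensionLT_one, ← projective_iff_hasProjectiveDimensionLT_one,
      projective_obj_iff]
  -- Dimension shifting applies only from here on: a projective module has a projective kernel which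
  -- need not vanish, so the bounds 0 and 1 are separate base cases.
  | n + 2 =>
    let S := ShortComplex.mk _ _ (kernel.condition (Projective.π M))
    have hS : S.ShortExact := { exact := ShortComplex.exact_kernel _ }
    have h₂ : Projective S.X₂ := inferInstanceAs (Projective (Projective.over M))
    rw [hS.hasProjectiveDimensionLT_X₃_iff n h₂, ← hasProjectiveDimensionLT_obj_iff S.X₁ (n + 1)]
    exact (hS.map_of_exact (forget₂ _ (ModuleCat.{u} R))).hasProjectiveDimensionLT_X₃_iff n
      ((projective_obj_iff _).2 h₂)

lemma projectiveDimension_obj_le_iff (M : FGModuleCat.{u} R) (n : ℕ) :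
    projectiveDimension M.obj ≤ n ↔ HasProjectiveDimensionLT M (n + 1) := by
  rw [projectiveDimension_le_iff, HasProjectiveDimensionLE, hasProjectiveDimensionLT_obj_iff]

lemma projectiveDimension_obj_ne_top_iff (M : FGModuleCat.{u} R) :
    projectiveDimension M.obj ≠ ⊤ ↔ ∃ n, HasProjectiveDimensionLT M n := by
  rw [projectiveDimension_ne_top_iff]
  simp only [HasProjectiveDimensionLE, hasProjectiveDimensionLT_obj_iff]
  exact ⟨fun ⟨n, hn⟩ ↦ ⟨_, hn⟩, fun ⟨n, hn⟩ ↦ ⟨n, hasProjectiveDimensionLT_of_ge M n _ (by lia)⟩⟩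

/-- A direct sum decomposition of modules is a biproduct decomposition in `mod R`. -/
noncomputable def isoBiprodOfProdEquiv {M A B : FGModuleCat.{u} R} (e : M ≃ₗ[R] A × B) :
    M ≅ A ⊞ B where
  hom := biprod.lift (ConcreteCategory.ofHom (LinearMap.fst R A B ∘ₗ e.toLinearMap))
    (ConcreteCategory.ofHom (LinearMap.snd R A B ∘ₗ e.toLinearMap))
  inv := biprod.desc (ConcreteCategory.ofHom (e.symm.toLinearMap ∘ₗ LinearMap.inl R A B))
    (ConcreteCategory.ofHom (e.symm.toLinearMap ∘ₗ LinearMap.inr R A B))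
  hom_inv_id := by
    rw [biprod.lift_desc]
    ext x
    change e.symm ((e x).1, 0) + e.symm (0, (e x).2) = x
    rw [← map_add]
    simp
  inv_hom_id := by
    apply biprod.hom_ext' <;> apply biprod.hom_ext
    all_goals
      simp only [biprod.inl_desc_assoc, biprod.inr_desc_assoc, Category.assoc, biprod.lift_fst,
        biprod.lift_snd, Category.comp_id, BinaryBicone.inl_fst, BinaryBicone.inl_snd,
        BinaryBicone.inr_fst, BinaryBicone.inr_snd]
      ext x
    · exact congrArg Prod.fst (e.apply_symm_apply (x, 0))
    · exact congrArg Prod.snd (e.apply_symm_apply (x, 0))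
    · exact congrArg Prod.fst (e.apply_symm_apply (0, x))
    · exact congrArg Prod.snd (e.apply_symm_apply (0, x))

variable (R) in
/-- `R^(n+1) ≅ R ⊕ R^n`. -/
noncomputable def freeSuccIso (n : ℕ) :
    of R (Fin (n + 1) → R) ≅ of R R ⊞ of R (Fin n → R) :=
  isoBiprodOfProdEquiv (A := of R R) (B := of R (Fin n → R))
    (Fin.consLinearEquiv R (fun _ ↦ R)).symm

variable (R) in
lemma free_of_regular (P : ObjectProperty (FGModuleCat.{u} R)) [P.IsClosedUnderIsomorphisms]
    (h₀ : ∀ X, IsZero X → P X) (h₁ : P (of R R)) (h₂ : ∀ X Y, P X → P Y → P (X ⊞ Y)) (n : ℕ) :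
    P (of R (Fin n → R)) := by
  induction n with
  | zero =>
    refine h₀ _ ((IsZero.iff_id_eq_zero _).2 ?_)
    ext x
    exact x.elim0
  | succ n ih => exact P.prop_of_iso (freeSuccIso R n).symm (h₂ _ _ h₁ ih)

end FGModuleCat

namespace WakamatsuSilting

lemma finitisticDimensionConjecture_iff (R : Type u) [Ring R] [IsNoetherianRing R] :
    FinitisticDimensionConjecture R ↔ ∃ n : ℕ, ∀ M : FGModuleCat.{u} R,
      (∃ m, HasProjectiveDimensionLT M m) → HasProjectiveDimensionLT M (n + 1) := by
  simp only [FinitisticDimensionConjecture, FGModuleCat.projectiveDimension_obj_le_iff,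
    FGModuleCat.projectiveDimension_obj_ne_top_iff]

end WakamatsuSilting

/-! ### Finite injective dimension of the regular module -/

namespace FGModuleCat

open Abelian

variable {R : Type u} [Ring R] [IsNoetherianRing R]

instance forget₂_preservesProjectiveObjects :
    (forget₂ (FGModuleCat.{u} R) (ModuleCat.{u} R)).PreservesProjectiveObjects where
  projective_obj h := (projective_obj_iff _).2 h

/-- The inclusion into all modules preserves projectives, so it identifies the `Ext` groups of
finitely generated modules; vanishing in the larger category is inherited. -/
lemma hasInjectiveDimensionLT_of_obj (M : FGModuleCat.{u} R) (n : ℕ)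
    (h : HasInjectiveDimensionLT M.obj n) : HasInjectiveDimensionLT M n := by
  let := HasExt.standard (FGModuleCat.{u} R)
  rw [hasInjectiveDimensionLT_iff]
  intro i hi Y e
  apply ((forget₂ (FGModuleCat.{u} R)
    (ModuleCat.{u} R)).mapExt_bijective_of_preservesProjectiveObjects Y M i).injective
  rw [map_zero]
  exact Ext.eq_zero_of_hasInjectiveDimensionLT (X := M.obj) _ n hi

lemma hasInjectiveDimensionLT_free (n k : ℕ) [HasInjectiveDimensionLT (of R R) n] :
    HasInjectiveDimensionLT (of R (Fin k → R)) n := by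
  let P : ObjectProperty (FGModuleCat.{u} R) := fun X ↦ HasInjectiveDimensionLT X n
  have : P.IsClosedUnderIsomorphisms := ⟨fun e (_ : HasInjectiveDimensionLT _ n) ↦
    hasInjectiveDimensionLT_of_iso e n⟩
  refine free_of_regular R P (fun X hX ↦ ?_) ‹_› (fun X Y hX hY ↦ ?_) k
  · have := hX.hasInjectiveDimensionLT_zero
    exact hasInjectiveDimensionLT_of_ge X 0 n (Nat.zero_le n)
  · exact (ShortComplex.Splitting.ofHasBinaryBiproduct X Y).shortExact.hasInjectiveDimensionLT_X₂ n
      hX hY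

/-- Lower the bound one step at a time: a class in `Ext^i(M, N)` lifts along a free cover of `N`,
since the obstruction lies one degree higher where `Ext` vanishes; the lift is zero because free
modules have small injective dimension. -/
lemma hasProjectiveDimensionLT_of_hasInjectiveDimensionLT_regular (n : ℕ)
    [HasInjectiveDimensionLT (of R R) n] (M : FGModuleCat.{u} R) (m : ℕ)
    (hM : HasProjectiveDimensionLT M (n + m)) : HasProjectiveDimensionLT M n := by
  induction m with
  | zero => exact hM
  | succ m ih =>
    suffices HasProjectiveDimensionLT M (n + m) from ih this
    let := HasExt.standard (FGModuleCat.{u} R)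
    rw [hasProjectiveDimensionLT_iff]
    intro i hi N e
    obtain ⟨k, f, _⟩ := exists_free_epi N
    let S := ShortComplex.mk _ _ (kernel.condition f)
    have hS : S.ShortExact := { exact := ShortComplex.exact_kernel _ }
    obtain ⟨x, rfl⟩ := Ext.covariant_sequence_exact₃ M hS e rfl
      (Ext.eq_zero_of_hasProjectiveDimensionLT _ (n + (m + 1)) (by lia))
    have := hasInjectiveDimensionLT_free (R := R) n k
    rw [Ext.eq_zero_of_hasInjectiveDimensionLT (X := of R (Fin k → R)) x n (by lia),
      Ext.zero_comp]

end FGModuleCat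

namespace WakamatsuSilting

theorem finitisticDimensionConjecture_of_injectiveDimension_ne_top (R : Type u) [Ring R]
    [IsNoetherianRing R] (h : injectiveDimension (ModuleCat.of R R) ≠ ⊤) :
    FinitisticDimensionConjecture R := by
  rw [finitisticDimensionConjecture_iff]
  obtain ⟨n, hn⟩ := (injectiveDimension_ne_top_iff _).1 h
  refine ⟨n, fun M ⟨m, hm⟩ ↦ ?_⟩
  have : HasInjectiveDimensionLT (FGModuleCat.of R R) (n + 1) :=
    FGModuleCat.hasInjectiveDimensionLT_of_obj _ _ hn
  have := hasProjectiveDimensionLT_of_ge M m (n + 1 + m) (by lia)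
  exact FGModuleCat.hasProjectiveDimensionLT_of_hasInjectiveDimensionLT_regular _ _ m this

end WakamatsuSilting

/-! ### Projective amplitude in the derived category -/

namespace DerivedCategory

open TStructure

variable {C : Type u} [Category.{v} C] [Abelian C] [HasDerivedCategory.{w} C]

lemma exists_Q_map_eq {K L : CochainComplex C ℤ} [K.IsKProjective] (f : Q.obj K ⟶ Q.obj L) :
    ∃ g : K ⟶ L, Q.map g = f := by
  obtain ⟨g, hg⟩ := (CochainComplex.IsKProjective.Qh_map_bijective K _).surjective
    ((quotientCompQhIso C).hom.app K ≫ f ≫ (quotientCompQhIso C).inv.app L)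
  obtain ⟨g, rfl⟩ := (HomotopyCategory.quotient _ _).map_surjective g
  refine ⟨g, ?_⟩
  rw [← cancel_epi ((quotientCompQhIso C).hom.app K), ← quotientCompQhIso_hom_naturality, hg]
  simp

/-- `X` is left orthogonal to all objects whose cohomology is concentrated in degrees `< n`; for
bounded complexes over a category with enough projectives this says that `X` is isomorphic to a
bounded complex of projectives in degrees `≥ n`. -/
def ProjGE (X : DerivedCategory C) (n : ℤ) : Prop :=
  ∀ (Y : DerivedCategory C) (m : ℤ), m < n → Y.IsLE m → ∀ f : X ⟶ Y, f = 0

lemma ProjGE.of_le {X : DerivedCategory C} {n m : ℤ} (hX : X.ProjGE n) (h : m ≤ n) :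
    X.ProjGE m :=
  fun Y k hk hY f ↦ hX Y k (by lia) hY f

lemma ProjGE.of_retract {X Y : DerivedCategory C} {n : ℤ} (hY : Y.ProjGE n) (r : Retract X Y) :
    X.ProjGE n := fun Z m hm hZ f ↦ by
  rw [← Category.id_comp f, ← r.retract, Category.assoc, hY Z m hm hZ (r.r ≫ f), comp_zero]

lemma ProjGE.of_iso {X Y : DerivedCategory C} {n : ℤ} (hX : X.ProjGE n) (e : X ≅ Y) :
    Y.ProjGE n :=
  hX.of_retract e.symm.retract

lemma ProjGE.shift {X : DerivedCategory C} {n : ℤ} (hX : X.ProjGE n) (a m : ℤ) (h : a + m = n) :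
    (X⟦a⟧).ProjGE m := fun Y k hk hY f ↦ by
  have := t.isLE_shift Y k (-a) (k + a)
  apply (shiftFunctor (DerivedCategory C) (-a)).map_injective
  let e : X ≅ X⟦a⟧⟦-a⟧ := (shiftEquiv _ a).unitIso.app X
  rw [Functor.map_zero, ← cancel_epi e.hom, comp_zero]
  exact hX _ _ (by lia) this _

lemma ProjGE.ext₂ {T : Triangle (DerivedCategory C)} (hT : T ∈ distTriang _) {n : ℤ}
    (h₁ : T.obj₁.ProjGE n) (h₃ : T.obj₃.ProjGE n) : T.obj₂.ProjGE n := fun Y m hm hY f ↦ by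
  obtain ⟨g, rfl⟩ := Triangle.yoneda_exact₂ T hT f (h₁ Y m hm hY _)
  rw [h₃ Y m hm hY g, comp_zero]

lemma ProjGE.ext₃ {T : Triangle (DerivedCategory C)} (hT : T ∈ distTriang _) {n : ℤ}
    (h₁ : T.obj₁.ProjGE (n + 1)) (h₂ : T.obj₂.ProjGE n) : T.obj₃.ProjGE n :=
  ProjGE.ext₂ (rot_of_distTriang _ hT) h₂ (h₁.shift 1 n (by lia))

/-- A morphism out of a K-projective complex is represented by a chain map, and source and target
have representatives in disjoint ranges of degrees. -/
lemma projGE_Q_obj (K : CochainComplex C ℤ) (n : ℤ) [K.IsKProjective] [K.IsStrictlyGE n] :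
    (Q.obj K).ProjGE n := fun Y m hm hY f ↦ by
  obtain ⟨L, _, ⟨e⟩⟩ := exists_iso_Q_obj_of_isLE Y m
  obtain ⟨g, hg⟩ := exists_Q_map_eq (f ≫ e.hom)
  have : g = 0 := by
    ext i
    by_cases hi : i < n
    · exact (K.isZero_of_isStrictlyGE n i hi).eq_of_src _ _
    · exact (L.isZero_of_isStrictlyLE m i (by lia)).eq_of_tgt _ _
  rw [← cancel_mono e.hom, ← hg, this, Functor.map_zero, zero_comp]

lemma projGE_singleFunctor (P : C) [Projective P] (n : ℤ) :
    ((singleFunctor C n).obj P).ProjGE n := by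
  have (i : ℤ) : Projective (((CochainComplex.singleFunctor C n).obj P).X i) := by
    by_cases hi : i = n
    · subst hi
      exact Projective.of_iso
        (HomologicalComplex.singleObjXSelf (ComplexShape.up ℤ) i P).symm inferInstance
    · exact (HomologicalComplex.isZero_single_obj_X (ComplexShape.up ℤ) n P i hi).projective
  have := CochainComplex.isKProjective_of_projective ((CochainComplex.singleFunctor C n).obj P) n
  exact projGE_Q_obj ((CochainComplex.singleFunctor C n).obj P) n

-- Links amplitude to modules: `Ext^i(M, N)` is `Hom(M, N[i])`, with `N[i]` in degrees `≤ -i`. The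
-- converse builds `M` from projectives by a finite resolution.
open Abelian in
lemma projGE_singleFunctor_iff [EnoughProjectives C] (M : C) (d : ℕ) :
    ((singleFunctor C 0).obj M).ProjGE (-d) ↔ HasProjectiveDimensionLT M (d + 1) := by
  refine ⟨fun h ↦ ?_, fun h ↦ ?_⟩
  · let := HasExt.standard C
    rw [hasProjectiveDimensionLT_iff]
    intro i hi N e
    have := t.isLE_shift ((singleFunctor C 0).obj N) 0 i (-i)
    ext
    rw [Ext.zero_hom]
    exact h _ (-i) (by lia) this _
  · induction d generalizing M with
    | zero =>
      have := projective_iff_hasProjectiveDimensionLT_one.2 h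
      exact projGE_singleFunctor M 0
    | succ d ih =>
      let S := ShortComplex.mk _ _ (kernel.condition (Projective.π M))
      have hS : S.ShortExact := { exact := ShortComplex.exact_kernel _ }
      have h₂ : Projective S.X₂ := inferInstanceAs (Projective (Projective.over M))
      refine ProjGE.ext₃ (hS.singleTriangle_distinguished) ?_ ?_
      · exact (ih S.X₁ ((hS.hasProjectiveDimensionLT_X₃_iff d h₂).1 h)).of_le (by lia)
      · exact (projGE_singleFunctor S.X₂ 0).of_le (by lia)

/-- The triangle of a projective mapping onto the top cohomology of an object of `D^≤0`. -/
lemma exists_triangle_of_isLE_zero [EnoughProjectives C] (X : DerivedCategory C) [X.IsLE 0] :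
    ∃ (P : C) (_ : Projective P) (X' : DerivedCategory C) (f : (singleFunctor C 0).obj P ⟶ X)
      (g : X ⟶ X') (h : X' ⟶ ((singleFunctor C 0).obj P)⟦(1 : ℤ)⟧),
      Triangle.mk f g h ∈ distTriang _ ∧ X'.IsLE (-1) := by
  obtain ⟨A, B, hA, hB, α, β, γ, hT⟩ := t.exists_triangle X (-1) 0 (by lia)
  replace hA : A.IsLE (-1) := ⟨hA⟩
  replace hB : B.IsGE 0 := ⟨hB⟩
  have hA1 := t.isLE_shift A (-1) 1 (-2)
  have hB' : B.IsLE 0 := t.isLE₂ _ (rot_of_distTriang _ hT) 0 ‹_›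
    (t.isLE_of_le (A⟦(1 : ℤ)⟧) (-2) 0)
  obtain ⟨H, ⟨e⟩⟩ := exists_iso_singleFunctor_obj_of_isGE_of_isLE B 0
  let S := ShortComplex.mk _ _ (kernel.condition (Projective.π H))
  have hS : S.ShortExact := { exact := ShortComplex.exact_kernel _ }
  have hP : Projective S.X₂ := inferInstanceAs (Projective (Projective.over H))
  let ψ : (singleFunctor C 0).obj S.X₂ ⟶ B := (singleFunctor C 0).map S.g ≫ e.inv
  -- The projective cover of the top cohomology lifts to `X`, the obstruction being a map from a
  -- projective in degree 0 to an object in degrees `≤ -2`.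
  obtain ⟨φ, hφ⟩ : ∃ φ : (singleFunctor C 0).obj S.X₂ ⟶ X, ψ = φ ≫ β :=
    Triangle.coyoneda_exact₃ _ hT ψ (projGE_singleFunctor S.X₂ 0 _ (-2) (by lia) hA1 _)
  obtain ⟨X', g, h, hT'⟩ := distinguished_cocone_triangle φ
  refine ⟨S.X₂, hP, X', φ, g, h, hT', (t.isLE_iff_orthogonal (-1) 0 (by lia) X').2 ?_⟩
  intro Y u hY
  have hP1 := t.isLE_shift ((singleFunctor C 0).obj S.X₂) 0 1 (-1)
  have hK1 := t.isLE_shift ((singleFunctor C 0).obj S.X₁) 0 1 (-1)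
  -- Any `u` killed by `g` factors through the shifted projective, which lies in degrees `≤ -1`. To
  -- get `g ≫ u = 0`, factor it through the top cohomology `B`; the factor vanishes on the
  -- projective mapping onto `B`, hence passes through the shifted kernel, again in degrees `≤ -1`.
  suffices hu : g ≫ u = 0 by
    obtain ⟨u', rfl⟩ : ∃ u' : ((singleFunctor C 0).obj S.X₂)⟦(1 : ℤ)⟧ ⟶ Y, u = h ≫ u' :=
      Triangle.yoneda_exact₃ _ hT' u hu
    rw [t.zero_of_isLE_of_isGE u' (-1) 0 (by lia) hP1 hY, comp_zero]
  obtain ⟨v, hv⟩ : ∃ v : B ⟶ Y, g ≫ u = β ≫ v := Triangle.yoneda_exact₂ _ hT (g ≫ u)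
    (t.zero_of_isLE_of_isGE _ (-1) 0 (by lia) hA hY)
  have hgv : (singleFunctor C 0).map S.g ≫ e.inv ≫ v = 0 := by
    have hφg : φ ≫ g = 0 := comp_distTriang_mor_zero₁₂ _ hT'
    rw [← Category.assoc]
    change ψ ≫ v = 0
    rw [hφ, Category.assoc, ← hv, reassoc_of% hφg, zero_comp]
  obtain ⟨v', hv'⟩ : ∃ v' : ((singleFunctor C 0).obj S.X₁)⟦(1 : ℤ)⟧ ⟶ Y,
      e.inv ≫ v = hS.singleδ ≫ v' :=
    Triangle.yoneda_exact₃ _ hS.singleTriangle_distinguished (e.inv ≫ v) hgv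
  rw [t.zero_of_isLE_of_isGE v' (-1) 0 (by lia) hK1 hY, comp_zero] at hv'
  rw [hv, (cancel_epi e.inv).1 (hv'.trans comp_zero.symm), comp_zero]

end DerivedCategory

/-! ### Dévissage along the cohomological amplitude -/

namespace DerivedCategory

open TStructure

variable {C : Type u} [Category.{v} C] [Abelian C] [HasDerivedCategory.{w} C] [EnoughProjectives C]

/-- The inductive step on amplitude: the cone of a projective mapping onto the top cohomology loses
degree 0, and shifting it back leaves an interval shorter by one. The source interval has length at
least one, so the shifted projective does not extend it downwards. -/
lemma exists_triangle_of_projGE (m : ℕ) (X : DerivedCategory C) (hX : X.IsGE (-(m + 1 : ℕ)))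
    (hX' : X.IsLE 0) (n : ℤ) (hn : X.ProjGE n) :
    ∃ (P : C) (_ : Projective P) (X' : DerivedCategory C) (f : (singleFunctor C 0).obj P ⟶ X)
      (g : X ⟶ X'⟦(1 : ℤ)⟧) (h : X'⟦(1 : ℤ)⟧ ⟶ ((singleFunctor C 0).obj P)⟦(1 : ℤ)⟧),
      Triangle.mk f g h ∈ distTriang _ ∧ X'.IsGE (-m) ∧ X'.IsLE 0 ∧ ∃ n', X'.ProjGE n' := by
  obtain ⟨P, hP, X', f, g, h, hT, hX''⟩ := exists_triangle_of_isLE_zero X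
  have hP1 := t.isGE_shift ((singleFunctor C 0).obj P) 0 1 (-1)
  have hge : X'.IsGE (-(m + 1 : ℕ)) := t.isGE₂ _ (rot_of_distTriang _ hT) _ hX
    (t.isGE_of_ge (((singleFunctor C 0).obj P)⟦(1 : ℤ)⟧) _ (-1) (by lia))
  have hn' : X'.ProjGE (min n (-1)) := ProjGE.ext₃ hT
    ((projGE_singleFunctor P 0).of_le (by lia)) (hn.of_le (min_le_left _ _))
  let e : X'⟦(-1 : ℤ)⟧⟦(1 : ℤ)⟧ ≅ X' := (shiftEquiv _ (1 : ℤ)).counitIso.app X'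
  refine ⟨P, hP, X'⟦(-1 : ℤ)⟧, f, g ≫ e.inv, e.hom ≫ h, ?_,
    t.isGE_shift X' (-(m + 1 : ℕ)) (-1) (-m) (by lia), t.isLE_shift X' (-1) (-1) 0,
    _, hn'.shift (-1) (min n (-1) + 1) (by lia)⟩
  exact isomorphic_distinguished _ hT _
    (Triangle.isoMk _ _ (Iso.refl ((singleFunctor C 0).obj P)) (Iso.refl X) e
      ((Category.comp_id f).trans (Category.id_comp f).symm)
      (((Category.assoc g e.inv e.hom).trans (by rw [e.inv_hom_id, Category.comp_id])).trans
        (Category.id_comp g).symm)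
      ((congrArg ((e.hom ≫ h) ≫ ·) (CategoryTheory.Functor.map_id _ _)).trans
        (Category.comp_id _)))

/-- Objects of finite projective amplitude lie in every triangulated subcategory containing the
projective objects, in amplitude `[-m, 0]`. -/
lemma prop_of_projGE_aux (S : ObjectProperty (DerivedCategory C)) [S.IsTriangulated]
    [S.IsClosedUnderIsomorphisms]
    (hS : ∀ P : C, Projective P → S ((singleFunctor C 0).obj P)) (m : ℕ)
    (X : DerivedCategory C) (hX : X.IsGE (-m)) (hX' : X.IsLE 0) (n : ℤ) (hn : X.ProjGE n) :
    S X := by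
  induction m generalizing X n with
  | zero =>
    have hX0 : X.IsGE 0 := by simpa using hX
    obtain ⟨M, ⟨e⟩⟩ := exists_iso_singleFunctor_obj_of_isGE_of_isLE X 0
    refine S.prop_of_iso e.symm ?_
    have hM := (projGE_singleFunctor_iff M n.natAbs).1 ((hn.of_le (by lia)).of_iso e)
    generalize n.natAbs = d at hM
    clear! n X
    induction d generalizing M with
    | zero => exact hS _ (projective_iff_hasProjectiveDimensionLT_one.2 hM)
    | succ d ih =>
      let E := ShortComplex.mk _ _ (kernel.condition (Projective.π M))
      have hE : E.ShortExact := { exact := ShortComplex.exact_kernel _ }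
      have h₂ : Projective E.X₂ := inferInstanceAs (Projective (Projective.over M))
      exact S.ext_of_isTriangulatedClosed₃ _ hE.singleTriangle_distinguished
        (ih E.X₁ ((hE.hasProjectiveDimensionLT_X₃_iff d h₂).1 hM)) (hS _ h₂)
  | succ m ih =>
    obtain ⟨P, hP, X', f, g, h, hT, h₁, h₂, n', hn'⟩ := exists_triangle_of_projGE m X hX hX' n hn
    exact S.ext_of_isTriangulatedClosed₂ _ hT (hS _ hP) (S.le_shift (1 : ℤ) _ (ih X' h₁ h₂ n' hn'))

lemma prop_of_projGE (S : ObjectProperty (DerivedCategory C)) [S.IsTriangulated]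
    [S.IsClosedUnderIsomorphisms]
    (hS : ∀ P : C, Projective P → S ((singleFunctor C 0).obj P))
    (X : DerivedCategory C) (a b n : ℤ) [X.IsGE a] [X.IsLE b] (hn : X.ProjGE n) :
    S X := by
  -- The absolute value also covers `b < a`, where the lower bound is merely weakened.
  have h₁ := t.isGE_of_ge X (b - (b - a).natAbs) a (by lia)
  have := prop_of_projGE_aux S hS (b - a).natAbs (X⟦b⟧) 
    (t.isGE_shift X (b - (b - a).natAbs) b _ (by lia))
    (t.isLE_shift X b b 0) _ (hn.shift b (n - b) (by lia))
  exact S.prop_of_iso ((shiftEquiv _ b).unitIso.symm.app X) (S.le_shift (-b) _ this)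

/-- Peeling off projectives reduces to a single module of finite projective dimension, to which the
finitistic bound applies. The initial bound `n` serves only as finiteness and disappears from the
conclusion. -/
lemma projGE_of_finitisticDimension_aux {d : ℕ}
    (hd : ∀ M : C, (∃ m, HasProjectiveDimensionLT M m) → HasProjectiveDimensionLT M (d + 1))
    (m : ℕ) (X : DerivedCategory C) (hX : X.IsGE (-m)) (hX' : X.IsLE 0) (n : ℤ)
    (hn : X.ProjGE n) : X.ProjGE (-m - d) := by
  induction m generalizing X n with
  | zero =>
    have hX0 : X.IsGE 0 := by simpa using hX
    obtain ⟨M, ⟨e⟩⟩ := exists_iso_singleFunctor_obj_of_isGE_of_isLE X 0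
    have hM := (projGE_singleFunctor_iff M n.natAbs).1 ((hn.of_le (by lia)).of_iso e)
    exact (((projGE_singleFunctor_iff M d).2 (hd M ⟨_, hM⟩)).of_iso e.symm).of_le (by lia)
  | succ m ih =>
    obtain ⟨P, hP, X', f, g, h, hT, h₁, h₂, n', hn'⟩ := exists_triangle_of_projGE m X hX hX' n hn
    exact ProjGE.ext₂ hT ((projGE_singleFunctor P 0).of_le (by lia))
      ((ih X' h₁ h₂ n' hn').shift 1 (-(m + 1 : ℕ) - d) (by lia))

lemma projGE_of_finitisticDimension {d : ℕ}
    (hd : ∀ M : C, (∃ m, HasProjectiveDimensionLT M m) → HasProjectiveDimensionLT M (d + 1))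
    (X : DerivedCategory C) {a b n : ℤ} (hab : a ≤ b) [X.IsGE a] [X.IsLE b] (hn : X.ProjGE n) :
    X.ProjGE (a - d) := by
  obtain ⟨m, rfl⟩ : ∃ m : ℕ, b = a + m := ⟨(b - a).toNat, by lia⟩
  have := projGE_of_finitisticDimension_aux hd m (X⟦a + m⟧) (t.isGE_shift X a _ _ (by lia))
    (t.isLE_shift X (a + m) _ 0) _ (hn.shift (a + m) (n - (a + m)) (by lia))
  exact (this.shift (-(a + m)) (a - d) (by lia)).of_iso ((shiftEquiv _ (a + m)).unitIso.symm.app X)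

end DerivedCategory

/-! ### Perfect complexes and compact Wakamatsu-silting complexes -/

namespace WakamatsuSilting

open ZeroObject DerivedCategory DerivedCategory.TStructure

variable {R : Type u} [Ring R] [IsNoetherianRing R]

lemma isKProjective_of_bounded_projective (P : CochainComplex (FGModuleCat.{u} R) ℤ) (b : ℤ)
    [P.IsStrictlyLE b] (hP : ∀ i, Module.Projective R (P.X i)) : P.IsKProjective := by
  have (i : ℤ) : Projective (P.X i) := (FGModuleCat.projective_iff _).2 (hP i)
  exact CochainComplex.isKProjective_of_projective P b

variable [HasDerivedCategory.{w} (FGModuleCat.{u} R)]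

instance perfect_isClosedUnderIsomorphisms : (perfect R).IsClosedUnderIsomorphisms where
  of_iso e := fun ⟨P, hP, hP', ⟨e'⟩⟩ ↦ ⟨P, hP, hP', ⟨e.symm ≪≫ e'⟩⟩

instance perfect_isStableUnderShift : (perfect R).IsStableUnderShift ℤ where
  isStableUnderShiftBy n :=
    { le_shift := fun X ⟨P, ⟨a, b, _, _⟩, hP, ⟨e⟩⟩ ↦
        ⟨P⟦n⟧, ⟨a - n, b - n, P.isStrictlyGE_shift a n (a - n) (by lia),
          P.isStrictlyLE_shift b n (b - n) (by lia)⟩, fun i ↦ hP (i + n),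
          ⟨(shiftFunctor _ n).mapIso e ≪≫ (Q.commShiftIso n).symm.app P⟩⟩ }

/-- A morphism between bounded complexes of projectives comes from a chain map, whose mapping cone
is again such a complex. -/
instance perfect_isTriangulatedClosed₃ : (perfect R).IsTriangulatedClosed₃ := by
  refine .mk' fun T hT ⟨P, ⟨a, b, _, _⟩, hP, ⟨e⟩⟩ ⟨P', ⟨a', b', _, _⟩, hP', ⟨e'⟩⟩ ↦ ?_
  have := isKProjective_of_bounded_projective P b hP
  obtain ⟨g, hg⟩ := exists_Q_map_eq (e.inv ≫ T.mor₁ ≫ e'.hom)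
  let eX (i : ℤ) : (CochainComplex.mappingCone g).X i ≅ P.X (i + 1) ⊞ P'.X i :=
    HomologicalComplex.homotopyCofiber.XIsoBiprod g i (i + 1) rfl
  refine ⟨CochainComplex.mappingCone g, ⟨min (a - 1) a', max b b', ?_, ?_⟩, fun i ↦ ?_, ?_⟩
  · rw [CochainComplex.isStrictlyGE_iff]
    intro i hi
    refine IsZero.of_iso ?_ (eX i)
    rw [biprod_isZero_iff]
    exact ⟨P.isZero_of_isStrictlyGE a _, P'.isZero_of_isStrictlyGE a' _⟩
  · rw [CochainComplex.isStrictlyLE_iff]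
    intro i hi
    refine IsZero.of_iso ?_ (eX i)
    rw [biprod_isZero_iff]
    exact ⟨P.isZero_of_isStrictlyLE b _, P'.isZero_of_isStrictlyLE b' _⟩
  · rw [← FGModuleCat.projective_iff]
    have h₁ := (FGModuleCat.projective_iff _).2 (hP (i + 1))
    have h₂ := (FGModuleCat.projective_iff _).2 (hP' i)
    exact Projective.of_iso (eX i).symm inferInstance
  · exact ⟨Triangle.π₃.mapIso (isoTriangleOfIso₁₂ _ _ hT (mappingCone_triangle_distinguished g)
      e e' (by change _ = e.hom ≫ Q.map g; rw [hg, Iso.hom_inv_id_assoc]; rfl))⟩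

lemma perfect_singleFunctor (P : FGModuleCat.{u} R) (hP : Projective P) :
    perfect R ((singleFunctor _ 0).obj P) := by
  refine ⟨(CochainComplex.singleFunctor _ 0).obj P, ⟨0, 0, inferInstance, inferInstance⟩,
    fun i ↦ ?_, ⟨Iso.refl _⟩⟩
  rw [← FGModuleCat.projective_iff]
  by_cases hi : i = 0
  · subst hi
    exact Projective.of_iso
      (HomologicalComplex.singleObjXSelf (ComplexShape.up ℤ) 0 P).symm hP
  · exact (HomologicalComplex.isZero_single_obj_X (ComplexShape.up ℤ) 0 P i hi).projective

instance perfect_isTriangulated : (perfect R).IsTriangulated where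
  exists_zero := ⟨(singleFunctor _ 0).obj 0, (singleFunctor _ 0).map_isZero (isZero_zero _),
    perfect_singleFunctor _ inferInstance⟩
  toIsTriangulatedClosed₂ := .of_isTriangulatedClosed₃

/-- Replaces the choice of a complex by orthogonality conditions, which visibly pass to retracts. -/
lemma perfect_iff (X : DerivedCategory (FGModuleCat.{u} R)) :
    perfect R X ↔ ∃ a b n : ℤ, X.IsGE a ∧ X.IsLE b ∧ X.ProjGE n := by
  refine ⟨fun ⟨P, ⟨a, b, _, _⟩, hP, ⟨e⟩⟩ ↦ ?_, fun ⟨a, b, n, _, _, hn⟩ ↦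
    prop_of_projGE _ perfect_singleFunctor X a b n hn⟩
  have := isKProjective_of_bounded_projective P b hP
  exact ⟨a, b, a, t.isGE_of_iso e.symm a, t.isLE_of_iso e.symm b,
    (projGE_Q_obj P a).of_iso e.symm⟩

lemma isGE_of_retract {X Y : DerivedCategory (FGModuleCat.{u} R)} (r : Retract X Y) (n : ℤ)
    [Y.IsGE n] : X.IsGE n := by
  refine (t.isGE_iff_orthogonal (n - 1) n (by lia) X).2 fun Z f _ ↦ ?_
  rw [← Category.comp_id f, ← r.retract, ← Category.assoc,
    t.zero (f ≫ r.i) (n - 1) n (by lia), zero_comp]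

lemma isLE_of_retract {X Y : DerivedCategory (FGModuleCat.{u} R)} (r : Retract X Y) (n : ℤ)
    [Y.IsLE n] : X.IsLE n := by
  refine (t.isLE_iff_orthogonal n (n + 1) rfl X).2 fun Z f _ ↦ ?_
  rw [← Category.id_comp f, ← r.retract, Category.assoc,
    t.zero (r.r ≫ f) n (n + 1) (by lia), comp_zero]

instance perfect_isStableUnderRetracts : (perfect R).IsStableUnderRetracts where
  of_retract r h := by
    rw [perfect_iff] at h ⊢
    obtain ⟨a, b, n, _, _, hn⟩ := h
    exact ⟨a, b, n, isGE_of_retract r a, isLE_of_retract r b, hn.of_retract r⟩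

lemma addClosure_le {T : DerivedCategory (FGModuleCat.{u} R)}
    (S : ObjectProperty (DerivedCategory (FGModuleCat.{u} R))) [S.IsTriangulated]
    [S.IsStableUnderRetracts] (hT : S T) : addClosure T ≤ S := fun X ⟨n, ⟨r⟩⟩ ↦ by
  refine S.prop_of_retract r (S.prop_of_iso (biproduct.isoProduct _).symm ?_)
  exact S.prop_pi _ (fun _ ↦ hT)

lemma hom_eq_zero_of_addClosure {T Z N : DerivedCategory (FGModuleCat.{u} R)}
    (hZ : leftPerp T Z) (hN : addClosure T N) (k : ℤ) (hk : 0 < k) (f : Z ⟶ N⟦k⟧) : f = 0 := by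
  obtain ⟨n, ⟨r⟩⟩ := hN
  have h : f ≫ r.i⟦k⟧' = 0 := by
    rw [← Category.comp_id (f ≫ r.i⟦k⟧'), ← CategoryTheory.Functor.map_id, ← biproduct.total,
      Functor.map_sum, Preadditive.comp_sum]
    refine Finset.sum_eq_zero fun j _ ↦ ?_
    rw [Functor.map_comp, ← Category.assoc]
    exact (congrArg (· ≫ _) (hZ k hk _)).trans zero_comp
  rw [← Category.comp_id f, ← CategoryTheory.Functor.map_id, ← r.retract, Functor.map_comp,
    ← Category.assoc, h, zero_comp]

/-- Dimension shifting along a coresolution by objects of `add T`. -/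
lemma hom_shift_eq_zero {T Z : DerivedCategory (FGModuleCat.{u} R)} (hZ : leftPerp T Z)
    {Y N : ℕ → DerivedCategory (FGModuleCat.{u} R)} (hN : ∀ i, addClosure T (N i))
    (hY : ∀ i, ∃ (f : Y i ⟶ N i) (g : N i ⟶ Y (i + 1)) (h : Y (i + 1) ⟶ (Y i)⟦(1 : ℤ)⟧),
      Triangle.mk f g h ∈ distTriang (DerivedCategory (FGModuleCat.{u} R)))
    (m : ℕ) (k : ℤ) (hk : 0 < k) (h₀ : ∀ f : Z ⟶ (Y 0)⟦k + m⟧, f = 0)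
    (f : Z ⟶ (Y m)⟦k⟧) : f = 0 := by
  induction m generalizing k with
  | zero =>
    let e : (Y 0)⟦k + (0 : ℕ)⟧ ≅ (Y 0)⟦k⟧ := eqToIso (by simp)
    rw [← cancel_mono e.inv, h₀ (f ≫ e.inv), zero_comp]
  | succ m ih =>
    -- Since `Z` has no maps to positive shifts of `N m`, the connecting map embeds `Hom(Z, (Y
    -- (m+1))[k])` into `Hom(Z, (Y m)[k+1])`.
    obtain ⟨u, v, h, hT⟩ := hY m
    let T' := (Triangle.shiftFunctor _ k).obj (Triangle.mk u v h)
    let e : (Y m)⟦k⟧⟦(1 : ℤ)⟧ ≅ (Y m)⟦k + 1⟧ := (shiftFunctorAdd _ k 1).symm.app (Y m)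
    let δ : (Y (m + 1))⟦k⟧ ⟶ (Y m)⟦k⟧⟦(1 : ℤ)⟧ := T'.mor₃
    have h₁ : f ≫ δ = 0 := by
      rw [← cancel_mono e.hom, zero_comp]
      refine ih (k + 1) (by lia) (fun g ↦ ?_) _
      let e' : (Y 0)⟦k + 1 + m⟧ ≅ (Y 0)⟦k + (m + 1 : ℕ)⟧ := eqToIso (by congr 2; push_cast; ring)
      rw [← cancel_mono e'.hom, h₀ (g ≫ e'.hom), zero_comp]
    obtain ⟨g, hg⟩ := Triangle.coyoneda_exact₃ T' (Triangle.shift_distinguished _ hT k) f h₁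
    rw [hg, hom_eq_zero_of_addClosure hZ (hN m) k hk g]
    exact zero_comp

/-- A triangulated subcategory closed under direct summands that contains `R` contains all perfect
complexes. -/
lemma perfect_le_of_regular (S : ObjectProperty (DerivedCategory (FGModuleCat.{u} R)))
    [S.IsTriangulated] [S.IsStableUnderRetracts] (hR : S (regular R)) : perfect R ≤ S := by
  intro X hX
  obtain ⟨a, b, n, _, _, hn⟩ := (perfect_iff X).1 hX
  refine prop_of_projGE S (fun P hP ↦ ?_) X a b n hn
  obtain ⟨k, f, hf⟩ := FGModuleCat.exists_free_epi P
  let r : Retract P (FGModuleCat.of R (Fin k → R)) := ⟨Projective.factorThru (𝟙 P) f, f, by simp⟩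
  refine S.prop_of_retract (r.map (singleFunctor _ 0)) ?_
  refine FGModuleCat.free_of_regular R (S.inverseImage (singleFunctor _ 0)) (fun X hX ↦ ?_) hR
    (fun X Y hX hY ↦ ?_) k
  · exact S.prop_of_isZero ((singleFunctor _ 0).map_isZero hX)
  · exact S.ext_of_isTriangulatedClosed₂ _ (ShortComplex.Splitting.ofHasBinaryBiproduct X
      Y).shortExact.singleTriangle_distinguished hX hY

theorem isSilting_of_isWakamatsuSilting (hR : FinitisticDimensionConjecture R)
    (T : DerivedCategory (FGModuleCat.{u} R)) (hT : perfect R T) (hW : IsWakamatsuSilting T) :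
    IsSilting T := by
  obtain ⟨d, hd⟩ := (finitisticDimensionConjecture_iff R).1 hR
  obtain ⟨X, n, ⟨a, b, -, Y, N, ⟨e₀⟩, hY⟩, ⟨e⟩⟩ := hW.regular_mem
  let S := (ObjectProperty.singleton T).triangEnvelope
  have hST : S T := ObjectProperty.le_triangEnvelope _ _ (by simp)
  have hN (i : ℕ) : addClosure T (N i) := (hY i).2.2.1
  have hR : perfect R (regular R) := perfect_singleFunctor _
    ((FGModuleCat.projective_iff _).2 (inferInstanceAs (Module.Projective R R)))
  have hperf (i : ℕ) : perfect R (Y i) := by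
    induction i with
    | zero =>
      refine (perfect R).prop_of_iso ?_ ((perfect R).le_shift (-(n : ℤ)) _ hR)
      exact (shiftFunctor _ (-(n : ℤ))).mapIso (e ≪≫ (shiftFunctor _ (n : ℤ)).mapIso e₀.symm) ≪≫
        (shiftEquiv _ (n : ℤ)).unitIso.symm.app (Y 0)
    | succ i ih =>
      obtain ⟨f, g, h, hT'⟩ := (hY i).2.2.2
      exact (perfect R).ext_of_isTriangulatedClosed₃ _ hT' ih (addClosure_le _ hT _ (hN i))
  have hproj (i : ℕ) : (Y i).ProjGE (a - d) := by
    obtain ⟨_, _, n, _, _, hn⟩ := (perfect_iff _).1 (hperf i)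
    obtain ⟨_, _⟩ := (hY i).2.1
    -- The interval is not assumed nonempty, while the amplitude bound needs `a ≤ b`.
    have := t.isLE_of_le (Y i) b (max a b) (le_max_right _ _)
    exact projGE_of_finitisticDimension hd (Y i) (le_max_left a b) hn
  have hend : ∃ m, S (Y m) := by
    -- Chosen so that `(Y 0)[m+1]`, in degrees `≤ b - m - 1`, lies strictly below `a - d`.
    let m := (b - a + d).toNat
    obtain ⟨f, g, h, hT'⟩ := (hY m).2.2.2
    obtain ⟨_, _⟩ := (hY 0).2.1
    have hh : h = 0 := hom_shift_eq_zero (hY (m + 1)).1 hN (fun i ↦ (hY i).2.2.2) m 1 (by lia)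
      (fun f ↦ hproj (m + 1) _ (b - (1 + m)) (by lia) (t.isLE_shift (Y 0) b _ _ (by lia)) f) h
    -- As `h` vanishes the triangle splits, making `Y (m+1)` a summand of `N m`.
    obtain ⟨s, hs⟩ : ∃ s : Y (m + 1) ⟶ N m, 𝟙 _ = s ≫ g :=
      Triangle.coyoneda_exact₃ _ hT' (𝟙 _) ((Category.id_comp _).trans hh)
    exact ⟨m + 1, S.prop_of_retract ⟨s, g, hs.symm⟩ (addClosure_le S hST _ (hN m))⟩
  obtain ⟨m, hm⟩ := hend
  have hS₀ : S (Y 0) := by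
    induction m with
    | zero => exact hm
    | succ m ih =>
      obtain ⟨f, g, h, hT'⟩ := (hY m).2.2.2
      exact ih (S.ext_of_isTriangulatedClosed₁ _ hT' (addClosure_le S hST _ (hN m)) hm)
  refine ⟨hT, hW.semiSelfOrthogonal, le_antisymm ?_ ?_⟩
  · rw [ObjectProperty.triangEnvelope_le_iff]
    simpa using hT
  · exact perfect_le_of_regular S (S.prop_of_iso e.symm
      (S.le_shift (n : ℤ) _ (S.prop_of_iso e₀ hS₀)))

end WakamatsuSilting

/-! ### Local endomorphism rings and Krull–Schmidt cancellation -/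

namespace CategoryTheory

variable {C : Type u} [Category.{v} C] [Abelian C]

/-- An object of an abelian category has a local endomorphism ring. -/
structure HasLocalEnd (X : C) : Prop where
  not_isZero : ¬ IsZero X
  isIso_or (f : X ⟶ X) : IsIso f ∨ IsIso (𝟙 X - f)

namespace HasLocalEnd

lemma isIso_or_of_add {X : C} (hX : HasLocalEnd X) (f g : X ⟶ X) (_ : IsIso (f + g)) :
    IsIso f ∨ IsIso g := by
  rcases hX.isIso_or (inv (f + g) ≫ f) with h | h
  · exact .inl (IsIso.of_isIso_comp_left (inv (f + g)) f)
  · have : 𝟙 X - inv (f + g) ≫ f = inv (f + g) ≫ g := by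
      rw [sub_eq_iff_eq_add, ← Preadditive.comp_add, add_comm g, IsIso.inv_hom_id]
    rw [this] at h
    exact .inr (IsIso.of_isIso_comp_left (inv (f + g)) g)

lemma exists_isIso_of_sum {X : C} (hX : HasLocalEnd X) {ι : Type*} (s : Finset ι)
    (f : ι → (X ⟶ X)) (h : IsIso (∑ i ∈ s, f i)) : ∃ i ∈ s, IsIso (f i) := by
  classical
  induction s using Finset.induction_on with
  | empty =>
    rw [Finset.sum_empty] at h
    refine (hX.not_isZero ((IsZero.iff_id_eq_zero X).2 ?_)).elim
    rw [← IsIso.hom_inv_id (0 : X ⟶ X), zero_comp]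
  | insert a s ha ih =>
    rw [Finset.sum_insert ha] at h
    rcases hX.isIso_or_of_add _ _ h with h | h
    · exact ⟨a, Finset.mem_insert_self _ _, h⟩
    · obtain ⟨i, hi, hi'⟩ := ih h
      exact ⟨i, Finset.mem_insert_of_mem hi, hi'⟩

/-- In a local endomorphism ring an idempotent is `0` or `1`. -/
lemma eq_zero_or_eq_id {X : C} (hX : HasLocalEnd X) (p : X ⟶ X) (hp : p ≫ p = p) :
    p = 0 ∨ p = 𝟙 X := by
  rcases hX.isIso_or p with h | h
  · exact .inr (by rw [← cancel_mono p, hp, Category.id_comp])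
  · exact .inl (by rw [← cancel_mono (𝟙 X - p)]; simp [hp])

lemma isIso_of_retract {X Y : C} (hX : ¬ IsZero X) (hY : HasLocalEnd Y) (r : Retract X Y) :
    IsIso r.i := by
  have h := r.retract
  rcases hY.eq_zero_or_eq_id (r.r ≫ r.i) (by simp) with h' | h'
  · refine (hX ((IsZero.iff_id_eq_zero X).2 ?_)).elim
    rw [← Category.comp_id (𝟙 X), ← h]
    simp only [Category.assoc]
    rw [reassoc_of% h', zero_comp, comp_zero]
  · exact ⟨r.r, h, h'⟩

/-- The first factor is a split monomorphism of the object into itself, and its complementary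
idempotent is trivial. -/
lemma isIso_of_isIso_comp {X : C} (hX : HasLocalEnd X) (f g : X ⟶ X) [IsIso (f ≫ g)] :
    IsIso f :=
  hX.isIso_of_retract hX.not_isZero ⟨f, g ≫ inv (f ≫ g), by rw [← Category.assoc]; simp⟩

lemma retract_or_of_retract_biprod {W A B : C} (hW : HasLocalEnd W) (r : Retract W (A ⊞ B)) :
    Nonempty (Retract W A) ∨ Nonempty (Retract W B) := by
  have h : (r.i ≫ biprod.fst) ≫ biprod.inl ≫ r.r + (r.i ≫ biprod.snd) ≫ biprod.inr ≫ r.r = 𝟙 W := by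
    rw [Category.assoc, Category.assoc, ← Preadditive.comp_add, ← Category.assoc,
      ← Category.assoc, ← Preadditive.add_comp, biprod.total, Category.id_comp, r.retract]
  have : IsIso ((r.i ≫ biprod.fst) ≫ biprod.inl ≫ r.r +
    (r.i ≫ biprod.snd) ≫ biprod.inr ≫ r.r) := by rw [h]; infer_instance
  rcases hW.isIso_or_of_add _ _ this with h' | h'
  · exact .inl ⟨⟨r.i ≫ biprod.fst, (biprod.inl ≫ r.r) ≫ inv ((r.i ≫ biprod.fst) ≫ biprod.inl ≫ r.r),
      by rw [← Category.assoc]; exact IsIso.hom_inv_id _⟩⟩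
  · exact .inr ⟨⟨r.i ≫ biprod.snd, (biprod.inr ≫ r.r) ≫ inv ((r.i ≫ biprod.snd) ≫ biprod.inr ≫ r.r),
      by rw [← Category.assoc]; exact IsIso.hom_inv_id _⟩⟩

lemma retract_of_retract_biproduct [HasFiniteBiproducts C] {W V : C}
    (hW : HasLocalEnd W) {n : ℕ}
    (r : Retract W (⨁ fun _ : Fin n ↦ V)) : Nonempty (Retract W V) := by
  let p (j : Fin n) : W ⟶ V := r.i ≫ biproduct.π (fun _ : Fin n ↦ V) j
  let q (j : Fin n) : V ⟶ W := biproduct.ι (fun _ : Fin n ↦ V) j ≫ r.r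
  have h : ∑ j, p j ≫ q j = 𝟙 W := by
    simp only [p, q, Category.assoc]
    rw [← Preadditive.comp_sum]
    simp only [← Category.assoc]
    rw [← Preadditive.sum_comp]
    exact (congrArg (fun x ↦ r.i ≫ x ≫ r.r) biproduct.total).trans (by simp)
  obtain ⟨j, -, hj⟩ := hW.exists_isIso_of_sum Finset.univ (fun j ↦ p j ≫ q j)
    (by rw [h]; infer_instance)
  exact ⟨⟨p j, q j ≫ inv (p j ≫ q j), by rw [← Category.assoc, IsIso.hom_inv_id]⟩⟩

/-- Objects with a local endomorphism ring can be cancelled from biproducts. -/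
lemma cancel {M A B : C} (hM : HasLocalEnd M) (e : M ⊞ A ≅ M ⊞ B) : Nonempty (A ≅ B) := by
  let α : M ⟶ M := biprod.inl ≫ e.hom ≫ biprod.fst
  let γ : M ⟶ B := biprod.inl ≫ e.hom ≫ biprod.snd
  let α' : M ⟶ M := biprod.inl ≫ e.inv ≫ biprod.fst
  let β' : B ⟶ M := biprod.inr ≫ e.inv ≫ biprod.fst
  have h : α ≫ α' + γ ≫ β' = 𝟙 M := by
    have h₁ : biprod.inl ≫ e.hom ≫ (biprod.fst ≫ biprod.inl + biprod.snd ≫ biprod.inr) ≫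
        e.inv ≫ biprod.fst = 𝟙 M := by simp [biprod.total]
    rw [← h₁]
    simp only [α, α', γ, β', Preadditive.comp_add, Preadditive.add_comp, Category.assoc]
  have : IsIso (α ≫ α' + γ ≫ β') := by rw [h]; infer_instance
  rcases hM.isIso_or_of_add (α ≫ α') (γ ≫ β') this with h' | h'
  · have : IsIso (biprod.inl ≫ e.hom ≫ biprod.fst) := hM.isIso_of_isIso_comp α α'
    exact ⟨Biprod.isoElim e⟩
  -- When `α` itself may fail to be invertible, a shear using the invertible `γ ≫ β'` changes the
  -- corner of `e` to `α + (𝟙 M - α)`, and Gaussian elimination applies.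
  · let s : B ⟶ M := β' ≫ inv (γ ≫ β') ≫ (𝟙 M - α)
    let e' : M ⊞ A ≅ M ⊞ B := e ≪≫ Biprod.unipotentLower s
    have hs : biprod.inl ≫ e'.hom ≫ biprod.fst = 𝟙 M := by
      have h₂ : γ ≫ s = 𝟙 M - α := by simp [s, ← Category.assoc]
      have h₃ : biprod.inl ≫ e'.hom ≫ biprod.fst = α + γ ≫ s := by
        simp [e', α, γ, Biprod.unipotentLower, Biprod.ofComponents]
      rw [h₃, h₂, add_sub_cancel]
    have : IsIso (biprod.inl ≫ e'.hom ≫ biprod.fst) := by rw [hs]; infer_instance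
    exact ⟨Biprod.isoElim e'⟩

end HasLocalEnd

variable (C) in
/-- A Krull–Schmidt category with Fitting decompositions of endomorphisms, for instance the
category of modules of finite length over a ring. -/
class HasFittingDecomposition : Prop where
  /-- Every object is a finite biproduct of objects with a local endomorphism ring. -/
  induction_local (P : ObjectProperty C) [P.IsClosedUnderIsomorphisms] (zero : ∀ X, IsZero X → P X)
    (local_end : ∀ X, HasLocalEnd X → P X) (biprod : ∀ X Y, P X → P Y → P (X ⊞ Y)) (X : C) : P X
  /-- Every endomorphism is the sum of an automorphism and a nilpotent endomorphism. -/
  fitting {X : C} (f : X ⟶ X) : ∃ (Y Z : C) (e : X ≅ Y ⊞ Z) (u : Y ⟶ Y) (z : Z ⟶ Z),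
    IsIso u ∧ IsNilpotent (End.of z) ∧ f = e.hom ≫ biprod.map u z ≫ e.inv

variable [HasFittingDecomposition C]

open HasFittingDecomposition

lemma biprod_cancel {M A B : C} (e : M ⊞ A ≅ M ⊞ B) : Nonempty (A ≅ B) := by
  let P : ObjectProperty C := fun M ↦ ∀ A B, Nonempty (M ⊞ A ≅ M ⊞ B) → Nonempty (A ≅ B)
  have : P.IsClosedUnderIsomorphisms := ⟨fun e h A B ⟨e'⟩ ↦ h A B
    ⟨biprod.mapIso e (Iso.refl A) ≪≫ e' ≪≫ biprod.mapIso e.symm (Iso.refl B)⟩⟩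
  refine induction_local P (fun M hM A B ⟨e⟩ ↦ ?_) (fun M hM A B ⟨e⟩ ↦ hM.cancel e)
    (fun X Y hX hY A B ⟨e⟩ ↦ ?_) M A B ⟨e⟩
  · have (A : C) : IsIso (biprod.inr : A ⟶ M ⊞ A) :=
      ⟨biprod.snd, by simp, biprod.hom_ext' _ _ (hM.eq_of_src _ _) (by simp)⟩
    exact ⟨asIso biprod.inr ≪≫ e ≪≫ (asIso biprod.inr).symm⟩
  · exact hY _ _ (hX _ _ ⟨(biprod.associator X Y A).symm ≪≫ e ≪≫ biprod.associator X Y B⟩)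

lemma exists_finite_local_retracts (V : C) :
    ∃ F : Set C, F.Finite ∧ ∀ W, HasLocalEnd W → Nonempty (Retract W V) →
      ∃ U ∈ F, Nonempty (W ≅ U) := by
  let P : ObjectProperty C := fun V ↦ ∃ F : Set C, F.Finite ∧ ∀ W, HasLocalEnd W →
    Nonempty (Retract W V) → ∃ U ∈ F, Nonempty (W ≅ U)
  have : P.IsClosedUnderIsomorphisms := ⟨fun e ⟨F, hF, h⟩ ↦ ⟨F, hF, fun W hW ⟨r⟩ ↦
    h W hW ⟨r.trans e.symm.retract⟩⟩⟩
  refine induction_local P (fun V hV ↦ ⟨∅, Set.finite_empty, fun W hW ⟨r⟩ ↦ ?_⟩)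
    (fun V hV ↦ ⟨{V}, Set.finite_singleton V, fun W hW ⟨r⟩ ↦ ⟨V, rfl, ?_⟩⟩)
    (fun X Y ⟨F, hF, h⟩ ⟨G, hG, h'⟩ ↦ ⟨F ∪ G, hF.union hG, fun W hW ⟨r⟩ ↦ ?_⟩) V
  · refine (hW.not_isZero ((IsZero.iff_id_eq_zero W).2 ?_)).elim
    rw [← r.retract, hV.eq_of_tgt r.i 0, zero_comp]
  · have := hV.isIso_of_retract hW.not_isZero r
    exact ⟨asIso r.i⟩
  · rcases hW.retract_or_of_retract_biprod r with hr | hr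
    · obtain ⟨U, hU, e⟩ := h W hW hr
      exact ⟨U, .inl hU, e⟩
    · obtain ⟨U, hU, e⟩ := h' W hW hr
      exact ⟨U, .inr hU, e⟩

/-- The projective dimension of an object is bounded by those of its indecomposable summands. -/
lemma hasProjectiveDimensionLT_of_local_retracts (Z : C) (n : ℕ)
    (h : ∀ W, HasLocalEnd W → Nonempty (Retract W Z) → HasProjectiveDimensionLT W n) :
    HasProjectiveDimensionLT Z n := by
  let P : ObjectProperty C := fun Z ↦ (∀ W, HasLocalEnd W → Nonempty (Retract W Z) →
    HasProjectiveDimensionLT W n) → HasProjectiveDimensionLT Z n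
  have : P.IsClosedUnderIsomorphisms := ⟨fun e h h' ↦
    have := h fun W hW ⟨r⟩ ↦ h' W hW ⟨r.trans e.retract⟩
    hasProjectiveDimensionLT_of_iso e n⟩
  refine induction_local P (fun X hX _ ↦ ?_) (fun X hX h ↦ h X hX ⟨.refl X⟩)
    (fun X Y hX hY h ↦ ?_) Z h
  · have := hX.hasProjectiveDimensionLT_zero
    exact hasProjectiveDimensionLT_of_ge X 0 n (Nat.zero_le n)
  · have h₁ := hX fun W hW ⟨r⟩ ↦ h W hW ⟨r.trans ⟨biprod.inl, biprod.fst, by simp⟩⟩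
    have h₂ := hY fun W hW ⟨r⟩ ↦ h W hW ⟨r.trans ⟨biprod.inr, biprod.snd, by simp⟩⟩
    infer_instance

end CategoryTheory

/-! ### Morphisms inducing isomorphisms on high `Ext`, and stable isomorphism -/

namespace CategoryTheory

open Abelian

variable {C : Type u} [Category.{v} C] [Abelian C]

/-- Two objects are stably isomorphic if they become isomorphic after adding projectives. -/
def StablyIso (A B : C) : Prop :=
  ∃ P Q : C, Projective P ∧ Projective Q ∧ Nonempty (A ⊞ P ≅ B ⊞ Q)

lemma StablyIso.symm {A B : C} : StablyIso A B → StablyIso B A :=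
  fun ⟨P, Q, hP, hQ, ⟨e⟩⟩ ↦ ⟨Q, P, hQ, hP, ⟨e.symm⟩⟩

variable [HasExt.{w} C]

/-- The morphism `g : A ⟶ B` induces bijections `Ext^i(B, N) → Ext^i(A, N)` for all `i > n`. -/
def ExtIso (n : ℕ) {A B : C} (g : A ⟶ B) : Prop :=
  ∀ (i : ℕ), n < i → ∀ N : C,
    Function.Bijective fun x : Ext B N i ↦ (Ext.mk₀ g).comp x (zero_add i)

namespace ExtIso

lemma mono {n m : ℕ} (h : n ≤ m) {A B : C} {g : A ⟶ B} (hg : ExtIso n g) : ExtIso m g :=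
  fun i hi N ↦ hg i (by lia) N

lemma comp {n : ℕ} {A B D : C} {f : A ⟶ B} {g : B ⟶ D} (hf : ExtIso n f) (hg : ExtIso n g) :
    ExtIso n (f ≫ g) := fun i hi N ↦ by
  convert (hf i hi N).comp (hg i hi N) using 2
  simp

lemma of_comp_left {n : ℕ} {A B D : C} {f : A ⟶ B} {g : B ⟶ D} (hf : ExtIso n f)
    (hfg : ExtIso n (f ≫ g)) : ExtIso n g := fun i hi N ↦ by
  rw [← Function.Bijective.of_comp_iff' (hf i hi N)]
  convert hfg i hi N using 2
  simp

lemma of_comp_right {n : ℕ} {A B D : C} {f : A ⟶ B} {g : B ⟶ D} (hg : ExtIso n g)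
    (hfg : ExtIso n (f ≫ g)) : ExtIso n f := fun i hi N ↦ by
  rw [← Function.Bijective.of_comp_iff _ (hg i hi N)]
  convert hfg i hi N using 2
  simp

lemma of_isIso {A B : C} (g : A ⟶ B) [IsIso g] (n : ℕ) : ExtIso n g := fun i hi N ↦ by
  refine Function.bijective_iff_has_inverse.2
    ⟨fun x ↦ (Ext.mk₀ (inv g)).comp x (zero_add i), fun x ↦ ?_, fun x ↦ ?_⟩ <;> simp

lemma of_hasProjectiveDimensionLT {A B : C} (g : A ⟶ B) (n : ℕ) [HasProjectiveDimensionLT A (n + 1)]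
    [HasProjectiveDimensionLT B (n + 1)] : ExtIso n g := fun i hi N ↦ by
  have h₁ := HasProjectiveDimensionLT.subsingleton A (n + 1) i hi N
  have h₂ := HasProjectiveDimensionLT.subsingleton B (n + 1) i hi N
  exact ⟨fun x y _ ↦ Subsingleton.elim x y, fun y ↦ ⟨0, Subsingleton.elim _ y⟩⟩

lemma biprod_map {n : ℕ} {A B A' B' : C} {f : A ⟶ B} {g : A' ⟶ B'} (hf : ExtIso n f)
    (hg : ExtIso n g) : ExtIso n (biprod.map f g) := fun i hi N ↦ by
  refine ⟨fun x y hxy ↦ ?_, fun y ↦ ?_⟩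
  · apply Ext.biprod_ext
    · apply (hf i hi N).injective
      simpa using congrArg (fun z ↦ (Ext.mk₀ (biprod.inl : A ⟶ A ⊞ A')).comp z (zero_add i)) hxy
    · apply (hg i hi N).injective
      simpa using congrArg (fun z ↦ (Ext.mk₀ (biprod.inr : A' ⟶ A ⊞ A')).comp z (zero_add i)) hxy
  · obtain ⟨a, ha⟩ := (hf i hi N).surjective ((Ext.mk₀ biprod.inl).comp y (zero_add i))
    obtain ⟨b, hb⟩ := (hg i hi N).surjective ((Ext.mk₀ biprod.inr).comp y (zero_add i))
    refine ⟨(Ext.mk₀ biprod.fst).comp a (zero_add i) + (Ext.mk₀ biprod.snd).comp b (zero_add i), ?_⟩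
    dsimp only at ha hb ⊢
    apply Ext.biprod_ext
    · rw [← ha]
      simp [Ext.comp_add]
    · rw [← hb]
      simp [Ext.comp_add]

lemma biprod_snd {A B A' B' : C} {n : ℕ} {f : A ⟶ B} {g : A' ⟶ B'}
    (h : ExtIso n (biprod.map f g)) : ExtIso n g := fun i hi N ↦ by
  refine ⟨fun x y hxy ↦ ?_, fun y ↦ ?_⟩
  · have : (Ext.mk₀ (biprod.snd : B ⊞ B' ⟶ B')).comp x (zero_add i) =
        (Ext.mk₀ biprod.snd).comp y (zero_add i) := by
      apply (h i hi N).injective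
      simpa using congrArg (fun z ↦ (Ext.mk₀ (biprod.snd : A ⊞ A' ⟶ A')).comp z (zero_add i)) hxy
    simpa using congrArg (fun z ↦ (Ext.mk₀ (biprod.inr : B' ⟶ B ⊞ B')).comp z (zero_add i)) this
  · obtain ⟨w, hw⟩ := (h i hi N).surjective ((Ext.mk₀ biprod.snd).comp y (zero_add i))
    refine ⟨(Ext.mk₀ biprod.inr).comp w (zero_add i), ?_⟩
    simpa using congrArg (fun z ↦ (Ext.mk₀ (biprod.inr : A' ⟶ A ⊞ A')).comp z (zero_add i)) hw

/-- A nilpotent endomorphism inducing bijections on `Ext^i` for `i > n` lives on an object of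
projective dimension at most `n`. -/
lemma hasProjectiveDimensionLT_of_isNilpotent {n : ℕ} {Z : C} {z : Z ⟶ Z} (hz : ExtIso n z)
    (h : IsNilpotent (End.of z)) : HasProjectiveDimensionLT Z (n + 1) := by
  have hpow (k : ℕ) : ExtIso n ((End.of z ^ k : End Z) : Z ⟶ Z) := by
    induction k with
    | zero => exact of_isIso (𝟙 Z) n
    | succ k ih =>
      rw [pow_succ]
      exact hz.comp ih
  obtain ⟨k, hk⟩ := h
  have h₀ : ExtIso n (0 : Z ⟶ Z) := by
    have := hpow k
    rwa [hk] at this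
  rw [hasProjectiveDimensionLT_iff]
  intro i hi N x
  apply (h₀ i hi N).injective
  simp

end ExtIso

namespace ShortComplex.ShortExact

variable {S : ShortComplex C}

lemma extIso_f (hS : S.ShortExact) (n : ℕ) [HasProjectiveDimensionLT S.X₃ (n + 1)] :
    ExtIso n S.f := fun i hi N ↦ by
  refine ⟨fun x y hxy ↦ ?_, fun y ↦ ?_⟩
  · rw [← sub_eq_zero]
    obtain ⟨z, hz⟩ := Ext.contravariant_sequence_exact₂ hS N (x - y) (by
      rw [sub_eq_add_neg, Ext.comp_add, Ext.comp_neg, ← sub_eq_add_neg, sub_eq_zero]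
      exact hxy)
    rw [← hz, z.eq_zero_of_hasProjectiveDimensionLT (n + 1) hi, Ext.comp_zero]
  · exact Ext.contravariant_sequence_exact₁ hS N y (add_comm 1 i)
      (Ext.eq_zero_of_hasProjectiveDimensionLT _ (n + 1) (by lia))

/-- In the long exact sequence `Ext^i(X₃, -)` is squeezed between isomorphisms in degrees `i - 1`
and `i`; needing both costs one degree compared with `extIso_f`. -/
lemma hasProjectiveDimensionLT_of_extIso_f (hS : S.ShortExact) {n : ℕ} (h : ExtIso n S.f) :
    HasProjectiveDimensionLT S.X₃ (n + 2) := by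
  rw [hasProjectiveDimensionLT_iff]
  intro i hi N x
  obtain ⟨i, rfl⟩ : ∃ j, i = 1 + j := ⟨i - 1, by lia⟩
  obtain ⟨x₁, rfl⟩ := Ext.contravariant_sequence_exact₃ hS N x (by
    apply (h (1 + i) (by lia) N).injective
    simp) rfl
  obtain ⟨x₂, rfl⟩ := (h i (by lia) N).surjective x₁
  simp

lemma extClass_comp_bijective (hS : S.ShortExact) [Projective S.X₂] (N : C) (i : ℕ) (hi : 0 < i) :
    Function.Bijective fun x : Ext S.X₁ N i ↦ hS.extClass.comp x (add_comm 1 i) := by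
  refine ⟨fun x y hxy ↦ ?_, fun y ↦ ?_⟩
  · rw [← sub_eq_zero]
    obtain ⟨z, hz⟩ := Ext.contravariant_sequence_exact₁ hS N (x - y) (add_comm 1 i) (by
      rw [sub_eq_add_neg, Ext.comp_add, Ext.comp_neg, ← sub_eq_add_neg, sub_eq_zero]
      exact hxy)
    rw [← hz, z.eq_zero_of_hasProjectiveDimensionLT 1 hi, Ext.comp_zero]
  · exact Ext.contravariant_sequence_exact₃ hS N y
      (Ext.eq_zero_of_hasProjectiveDimensionLT _ 1 (by lia)) (add_comm 1 i)

end ShortComplex.ShortExact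

/-- Dimension shifting: a morphism of projective presentations. -/
lemma extIso_τ₁_iff {S S' : ShortComplex C} (hS : S.ShortExact) (hS' : S'.ShortExact)
    [Projective S.X₂] [Projective S'.X₂] (φ : S ⟶ S') (n : ℕ) :
    ExtIso n φ.τ₁ ↔ ExtIso (n + 1) φ.τ₃ := by
  have key (i : ℕ) (hi : 0 < i) (N : C) :
      (Function.Bijective fun x : Ext S'.X₁ N i ↦ (Ext.mk₀ φ.τ₁).comp x (zero_add i)) ↔
        Function.Bijective fun x : Ext S'.X₃ N (i + 1) ↦
          (Ext.mk₀ φ.τ₃).comp x (zero_add (i + 1)) := by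
    rw [← Function.Bijective.of_comp_iff' (hS.extClass_comp_bijective N i hi),
      ← Function.Bijective.of_comp_iff _ (hS'.extClass_comp_bijective N i hi)]
    refine Eq.to_iff (congrArg Function.Bijective (funext fun x ↦ ?_))
    have h := ShortComplex.ShortExact.extClass_naturality hS hS' φ
    have h' := congrArg (fun y : Ext S.X₃ S'.X₁ 1 ↦ y.comp x (add_comm 1 i)) h
    dsimp only [Function.comp_apply] at h' ⊢
    rw [Ext.comp_assoc_of_second_deg_zero] at h'
    rw [h', Ext.comp_assoc (a₁₂ := 1) (a₂₃ := i + 1) _ _ _ (by lia) (by lia) (by lia)]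
  refine ⟨fun h i hi N ↦ ?_, fun h i hi N ↦ (key i (by lia) N).2 (h (i + 1) (by lia) N)⟩
  obtain ⟨i, rfl⟩ : ∃ j, i = j + 1 := ⟨i - 1, by lia⟩
  exact (key i (by lia) N).1 (h i (by lia) N)

lemma extIso_inl (A P : C) [Projective P] : ExtIso 0 (biprod.inl : A ⟶ A ⊞ P) := fun i hi N ↦ by
  refine ⟨fun x y hxy ↦ Ext.biprod_ext hxy ?_, fun y ↦
    ⟨(Ext.mk₀ biprod.fst).comp y (zero_add i), by simp⟩⟩
  rw [Ext.eq_zero_of_hasProjectiveDimensionLT ((Ext.mk₀ biprod.inr).comp x (zero_add i)) 1 hi,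
    Ext.eq_zero_of_hasProjectiveDimensionLT ((Ext.mk₀ biprod.inr).comp y (zero_add i)) 1 hi]

lemma extIso_fst (A P : C) [Projective P] : ExtIso 0 (biprod.fst : A ⊞ P ⟶ A) :=
  (extIso_inl A P).of_comp_left (by rw [biprod.inl_fst]; exact .of_isIso _ _)

lemma StablyIso.exists_extIso {A B : C} (h : StablyIso A B) : ∃ g : A ⟶ B, ExtIso 0 g := by
  obtain ⟨P, Q, hP, hQ, ⟨e⟩⟩ := h
  exact ⟨biprod.inl ≫ e.hom ≫ biprod.fst,
    (extIso_inl A P).comp ((ExtIso.of_isIso e.hom 0).comp (extIso_fst B Q))⟩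

/-- Adding a projective makes `g` an epimorphism `h`. Its extension class dies after pullback along
`h`, so injectivity on `Ext^1` splits it, and surjectivity on `Ext^1` forces the kernel to be
projective. -/
lemma ExtIso.stablyIso [EnoughProjectives C] {A B : C} {g : A ⟶ B} (hg : ExtIso 0 g) :
    StablyIso A B := by
  let h : A ⊞ Projective.over B ⟶ B := biprod.desc g (Projective.π B)
  have : Epi h := epi_of_epi_fac (biprod.inr_desc g (Projective.π B))
  have hh : ExtIso 0 h := (extIso_inl A (Projective.over B)).of_comp_left
    (by rwa [biprod.inl_desc])
  let S := ShortComplex.mk _ _ (kernel.condition h)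
  have hS : S.ShortExact := { exact := ShortComplex.exact_kernel _ }
  have h₀ : hS.extClass = 0 := by
    apply (hh 1 one_pos _).injective
    exact hS.comp_extClass.trans (Ext.comp_zero _ _ _ _ _).symm
  obtain ⟨x, hx⟩ := Ext.contravariant_sequence_exact₁ hS S.X₁ (Ext.mk₀ (𝟙 S.X₁)) (add_zero 1)
    (by rw [h₀, Ext.zero_comp])
  obtain ⟨r, rfl⟩ := (Ext.mk₀_bijective _ _).surjective x
  have hr : S.f ≫ r = 𝟙 S.X₁ := by
    rw [Ext.mk₀_comp_mk₀] at hx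
    exact (Ext.mk₀_bijective _ _).injective hx
  let σ := ShortComplex.Splitting.ofExactOfRetraction S hS.exact r hr hS.epi_g
  have hK : Projective S.X₁ := by
    rw [projective_iff_subsingleton_ext_one]
    refine fun N ↦ ⟨fun x y ↦ ?_⟩
    suffices ∀ x : Ext S.X₁ N 1, x = 0 from (this x).trans (this y).symm
    intro x
    obtain ⟨z, hz⟩ := (hh 1 one_pos N).surjective ((Ext.mk₀ r).comp x (zero_add 1))
    have hz' := congrArg (fun y ↦ (Ext.mk₀ S.f).comp y (zero_add 1)) hz
    dsimp only at hz'
    rw [Ext.mk₀_comp_mk₀_assoc, Ext.mk₀_comp_mk₀_assoc, hr, Ext.mk₀_id_comp] at hz'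
    rw [← hz', kernel.condition, Ext.mk₀_zero, Ext.zero_comp]
  exact ⟨Projective.over B, S.X₁, inferInstance, hK,
    ⟨σ.isoBinaryBiproduct ≪≫ biprod.braiding _ _⟩⟩

end CategoryTheory

/-! ### A uniform iterate on finitely generated submonoids -/

/-- Fitting's lemma for an endomorphism of a cancellative commutative monoid, restricted to a
finitely generated submonoid: equality under some iterate is equality under a uniform iterate. -/
lemma AddMonoidHom.exists_iterate_eq_of_finite {M : Type*} [AddCommMonoid M] [IsCancelAdd M]
    (φ : M →+ M) {F : Set M} (hF : F.Finite) :
    ∃ n : ℕ, ∀ x ∈ AddSubmonoid.closure F, ∀ y ∈ AddSubmonoid.closure F, ∀ r : ℕ,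
      φ^[r] x = φ^[r] y → φ^[n] x = φ^[n] y := by
  let ι : M →+ Algebra.GrothendieckAddGroup M := Algebra.GrothendieckAddGroup.of
  have hι : Function.Injective ι := Algebra.GrothendieckAddGroup.of_injective
  let Φ : Algebra.GrothendieckAddGroup M →ₗ[ℤ] Algebra.GrothendieckAddGroup M :=
    (Algebra.GrothendieckAddGroup.lift (ι.comp φ)).toIntLinearMap
  have hΦ (x : M) : Φ (ι x) = ι (φ x) :=
    DFunLike.congr_fun (Algebra.GrothendieckAddGroup.lift.symm_apply_apply (ι.comp φ)) x
  have hΦ' (r : ℕ) (x : M) : (Φ ^ r) (ι x) = ι (φ^[r] x) := by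
    induction r with
    | zero => rfl
    | succ r ih => rw [pow_succ', Module.End.mul_apply, ih, hΦ, Function.iterate_succ_apply']
  let H : Submodule ℤ (Algebra.GrothendieckAddGroup M) := Submodule.span ℤ (ι '' F)
  have : IsNoetherian ℤ H := isNoetherian_span_of_finite ℤ (hF.image ι)
  have hH {x : M} (hx : x ∈ AddSubmonoid.closure F) : ι x ∈ H := by
    induction hx using AddSubmonoid.closure_induction with
    | mem x hx => exact Submodule.subset_span ⟨x, hx, rfl⟩
    | zero => rw [map_zero]; exact H.zero_mem
    | add x y _ _ hx hy => rw [map_add]; exact H.add_mem hx hy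
  -- `H` need not be stable under `Φ`, but the kernels of the powers of `Φ`, intersected with `H`,
  -- still form an ascending chain of subgroups of a Noetherian group.
  obtain ⟨n, hn⟩ := monotone_stabilizes_iff_noetherian.2 this
    ⟨fun r ↦ (Φ.iterateKer r).comap H.subtype,
      fun r s h ↦ Submodule.comap_mono (Φ.iterateKer.monotone h)⟩
  refine ⟨n, fun x hx y hy r hr ↦ hι ?_⟩
  have h₁ : (⟨ι x - ι y, H.sub_mem (hH hx) (hH hy)⟩ : H) ∈
      (Φ.iterateKer (max n r)).comap H.subtype := by
    refine Φ.iterateKer.monotone (le_max_right n r) ?_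
    change (Φ ^ r) (ι x - ι y) = 0
    rw [map_sub, hΦ', hΦ', hr, sub_self]
  have h₂ := (hn _ (le_max_left n r)).symm.le h₁
  have h₃ : (Φ ^ n) (ι x - ι y) = 0 := h₂
  rwa [map_sub, hΦ', hΦ', sub_eq_zero] at h₃

/-! ### Syzygies on stable classes and the Igusa–Todorov bound -/

namespace CategoryTheory

open Abelian ZeroObject

variable {C : Type u} [Category.{v} C] [Abelian C]

lemma ShortComplex.ShortExact.biprod {S S' : ShortComplex C} (hS : S.ShortExact)
    (hS' : S'.ShortExact) :
    (ShortComplex.mk (biprod.map S.f S'.f) (biprod.map S.g S'.g)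
      (by ext <;> simp)).ShortExact := by
  have := hS.mono_f
  have := hS'.mono_f
  have := hS.epi_g
  have := hS'.epi_g
  refine { exact := ShortComplex.exact_of_f_is_kernel _ ?_, mono_f := ?_, epi_g := ?_ }
  · refine KernelFork.IsLimit.ofι' _ _ fun {A} k hk ↦
      ⟨biprod.lift (hS.exact.lift (k ≫ biprod.fst) ?_) (hS'.exact.lift (k ≫ biprod.snd) ?_), ?_⟩
    · simpa using hk =≫ biprod.fst
    · simpa using hk =≫ biprod.snd
    · ext <;> simp
  · dsimp only; infer_instance
  · dsimp only; infer_instance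

lemma ShortComplex.ShortExact.exists_hom_of_projective {S S' : ShortComplex C}
    (hS' : S'.ShortExact) [Projective S.X₂] (g : S.X₃ ⟶ S'.X₃) :
    ∃ φ : S ⟶ S', φ.τ₃ = g := by
  have := hS'.epi_g
  have := hS'.mono_f
  let τ₂ : S.X₂ ⟶ S'.X₂ := Projective.factorThru (S.g ≫ g) S'.g
  have h : τ₂ ≫ S'.g = S.g ≫ g := Projective.factorThru_comp _ _
  exact ⟨{ τ₁ := hS'.exact.lift (S.f ≫ τ₂) (by rw [Category.assoc, h, S.zero_assoc, zero_comp])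
           τ₂ := τ₂
           τ₃ := g
           comm₁₂ := by simp
           comm₂₃ := h }, rfl⟩

/-- The indecomposable summands of `X` are projective or isomorphic to an object of `G`. -/
def LocalRetractsIn (G : Set C) (X : C) : Prop :=
  ∀ W, HasLocalEnd W → Nonempty (Retract W X) → Projective W ∨ ∃ U ∈ G, Nonempty (W ≅ U)

lemma LocalRetractsIn.biprod {G : Set C} {X Y : C} (hX : LocalRetractsIn G X)
    (hY : LocalRetractsIn G Y) : LocalRetractsIn G (X ⊞ Y) := fun W hW ⟨r⟩ ↦
  (hW.retract_or_of_retract_biprod r).elim (hX W hW) (hY W hW)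

lemma LocalRetractsIn.of_stablyIso {G : Set C} {X Y : C} (h : StablyIso X Y)
    (hY : LocalRetractsIn G Y) : LocalRetractsIn G X := fun W hW ⟨r⟩ ↦ by
  obtain ⟨P, Q, hP, hQ, ⟨e⟩⟩ := h
  have r' : Retract W (Y ⊞ Q) :=
    (r.trans ⟨biprod.inl, biprod.fst, biprod.inl_fst⟩).trans e.retract
  rcases hW.retract_or_of_retract_biprod r' with h | ⟨⟨r''⟩⟩
  · exact hY W hW h
  · exact .inl r''.projective

open WakamatsuSilting in
/-- Induction for the objects of `add V`: they are biproducts of indecomposable summands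
of `V`. -/
lemma addClosure_induction [HasFittingDecomposition C] [HasFiniteBiproducts C] {V : C} (P : ObjectProperty C)
    [P.IsClosedUnderIsomorphisms] (zero : ∀ X, IsZero X → P X)
    (local_end : ∀ W, HasLocalEnd W → Nonempty (Retract W V) → P W)
    (biprod_mem : ∀ X Y, P X → P Y → P (X ⊞ Y)) {X : C} (hX : addClosure V X) : P X := by
  obtain ⟨m, ⟨r⟩⟩ := hX
  let P' : ObjectProperty C := fun X ↦ Nonempty (Retract X (⨁ fun _ : Fin m ↦ V)) → P X
  have : P'.IsClosedUnderIsomorphisms :=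
    ⟨fun e h ⟨r⟩ ↦ P.prop_of_iso e (h ⟨e.retract.trans r⟩)⟩
  exact HasFittingDecomposition.induction_local P' (fun X hX _ ↦ zero X hX)
    (fun X hX ⟨r⟩ ↦ local_end X hX (hX.retract_of_retract_biproduct r))
    (fun X Y hX hY ⟨r⟩ ↦ biprod_mem X Y (hX ⟨.trans ⟨biprod.inl, biprod.fst, biprod.inl_fst⟩ r⟩)
      (hY ⟨.trans ⟨biprod.inr, biprod.snd, biprod.inr_snd⟩ r⟩)) X ⟨r⟩

variable [EnoughProjectives C]

lemma StablyIso.of_iso {A B : C} (e : A ≅ B) : StablyIso A B :=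
  let := HasExt.standard C
  (ExtIso.of_isIso e.hom 0).stablyIso

lemma StablyIso.trans {A B D : C} (h : StablyIso A B) (h' : StablyIso B D) : StablyIso A D := by
  let := HasExt.standard C
  obtain ⟨f, hf⟩ := h.exists_extIso
  obtain ⟨g, hg⟩ := h'.exists_extIso
  exact (hf.comp hg).stablyIso

lemma StablyIso.biprod {A B A' B' : C} (h : StablyIso A B) (h' : StablyIso A' B') :
    StablyIso (A ⊞ A') (B ⊞ B') := by
  let := HasExt.standard C
  obtain ⟨f, hf⟩ := h.exists_extIso
  obtain ⟨g, hg⟩ := h'.exists_extIso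
  exact (hf.biprod_map hg).stablyIso

/-- The first terms of two projective presentations of stably isomorphic objects are stably
isomorphic. -/
lemma StablyIso.of_shortExact {S S' : ShortComplex C} (hS : S.ShortExact) (hS' : S'.ShortExact)
    [Projective S.X₂] [Projective S'.X₂] (h : StablyIso S.X₃ S'.X₃) : StablyIso S.X₁ S'.X₁ := by
  let := HasExt.standard C
  obtain ⟨g, hg⟩ := h.exists_extIso
  obtain ⟨φ, rfl⟩ := hS'.exists_hom_of_projective g
  exact ((extIso_τ₁_iff hS hS' φ 0).2 (hg.mono (Nat.zero_le _))).stablyIso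

/-- The chosen projective presentation `0 ⟶ Ω X ⟶ P ⟶ X ⟶ 0`. -/
noncomputable def syzygyShortComplex (X : C) : ShortComplex C :=
  .mk _ _ (kernel.condition (Projective.π X))

/-- The chosen first syzygy of an object. -/
noncomputable abbrev syzygy (X : C) : C := (syzygyShortComplex X).X₁

lemma syzygyShortComplex_shortExact (X : C) : (syzygyShortComplex X).ShortExact where
  exact := ShortComplex.exact_kernel _
  mono_f := by dsimp only [syzygyShortComplex]; infer_instance
  epi_g := by dsimp only [syzygyShortComplex]; infer_instance

instance (X : C) : Projective (syzygyShortComplex X).X₂ := by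
  dsimp only [syzygyShortComplex]; infer_instance

lemma StablyIso.syzygy {A B : C} (h : StablyIso A B) : StablyIso (syzygy A) (syzygy B) :=
  .of_shortExact (syzygyShortComplex_shortExact A) (syzygyShortComplex_shortExact B) h

lemma stablyIso_syzygy_biprod (A B : C) : StablyIso (syzygy (A ⊞ B)) (syzygy A ⊞ syzygy B) := by
  have : Projective ((syzygyShortComplex A).X₂ ⊞ (syzygyShortComplex B).X₂) := inferInstance
  exact .of_shortExact (syzygyShortComplex_shortExact (A ⊞ B))
    ((syzygyShortComplex_shortExact A).biprod (syzygyShortComplex_shortExact B))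
    (.of_iso (Iso.refl (A ⊞ B)))

/-- Lift the map through the chosen projective presentations; each syzygy lowers the `Ext` threshold
by exactly one. -/
lemma exists_iterate_syzygy_hom [HasExt.{w} C] {A B : C} (g : A ⟶ B) (n : ℕ) :
    ∃ g' : CategoryTheory.syzygy^[n] A ⟶ CategoryTheory.syzygy^[n] B,
      ∀ k, ExtIso k g' ↔ ExtIso (k + n) g := by
  induction n generalizing A B with
  | zero => exact ⟨g, fun k ↦ Iff.rfl⟩
  | succ n ih =>
    obtain ⟨φ, hφ⟩ := (syzygyShortComplex_shortExact B).exists_hom_of_projective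
      (S := syzygyShortComplex A) g
    obtain ⟨g', hg'⟩ := ih φ.τ₁
    refine ⟨g', fun k ↦ (hg' k).trans ?_⟩
    rw [extIso_τ₁_iff (syzygyShortComplex_shortExact A) (syzygyShortComplex_shortExact B), hφ]
    rfl

lemma StablyIso.iterate_syzygy {A B : C} (h : StablyIso A B) (n : ℕ) :
    StablyIso (CategoryTheory.syzygy^[n] A) (CategoryTheory.syzygy^[n] B) := by
  induction n generalizing A B with
  | zero => exact h
  | succ n ih => exact ih h.syzygy

lemma stablyIso_iterate_syzygy_biprod (A B : C) (n : ℕ) :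
    StablyIso (syzygy^[n] (A ⊞ B)) (syzygy^[n] A ⊞ syzygy^[n] B) := by
  induction n generalizing A B with
  | zero => exact .of_iso (Iso.refl _)
  | succ n ih => exact ((stablyIso_syzygy_biprod A B).iterate_syzygy n).trans (ih _ _)

variable (C) in
/-- The setoid of stably isomorphic objects. -/
def stablyIsoSetoid : Setoid C where
  r := StablyIso
  iseqv := ⟨fun X ↦ .of_iso (Iso.refl X), StablyIso.symm, StablyIso.trans⟩

variable (C) in
/-- The commutative monoid of stable isomorphism classes of objects. -/
def StableClass : Type u := _root_.Quotient (stablyIsoSetoid C)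

namespace StableClass

/-- The stable isomorphism class of an object. -/
def mk (X : C) : StableClass C := _root_.Quotient.mk (stablyIsoSetoid C) X

lemma mk_eq_mk_iff {X Y : C} : mk X = mk Y ↔ StablyIso X Y := _root_.Quotient.eq (r := stablyIsoSetoid C)

lemma ind {P : StableClass C → Prop} (h : ∀ X, P (mk X)) (x : StableClass C) : P x :=
  _root_.Quotient.ind h x

noncomputable instance : Add (StableClass C) :=
  ⟨_root_.Quotient.map₂ (fun X Y ↦ X ⊞ Y) fun _ _ h _ _ h' ↦ h.biprod h'⟩

noncomputable instance : Zero (StableClass C) := ⟨mk 0⟩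

lemma mk_biprod (X Y : C) : mk (X ⊞ Y) = mk X + mk Y := rfl

lemma mk_eq_zero {X : C} (hX : IsZero X) : mk X = 0 :=
  mk_eq_mk_iff.2 (.of_iso (hX.iso (isZero_zero C)))

noncomputable instance : AddCommMonoid (StableClass C) where
  add_assoc a b c := by
    induction a using ind
    induction b using ind
    induction c using ind
    exact mk_eq_mk_iff.2 (.of_iso (biprod.associator _ _ _))
  zero_add a := by
    induction a using ind
    exact mk_eq_mk_iff.2 (.of_iso (isoZeroBiprod (isZero_zero C)).symm)
  add_zero a := by
    induction a using ind
    exact mk_eq_mk_iff.2 (.of_iso (isoBiprodZero (isZero_zero C)).symm)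
  add_comm a b := by
    induction a using ind
    induction b using ind
    exact mk_eq_mk_iff.2 (.of_iso (biprod.braiding _ _))
  nsmul := nsmulRec

instance [HasFittingDecomposition C] : IsCancelAdd (StableClass C) :=
  have : IsLeftCancelAdd (StableClass C) := ⟨fun a b c h ↦ by
    induction a using ind with | h A
    induction b using ind with | h B
    induction c using ind with | h D
    dsimp only at h
    rw [← mk_biprod, ← mk_biprod, mk_eq_mk_iff] at h
    obtain ⟨P, Q, hP, hQ, ⟨e⟩⟩ := h
    exact mk_eq_mk_iff.2 ⟨P, Q, hP, hQ, biprod_cancel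
      ((biprod.associator A B P).symm ≪≫ e ≪≫ biprod.associator A D Q)⟩⟩
  AddCommMagma.IsLeftCancelAdd.toIsCancelAdd _

/-- The syzygy operator on stable isomorphism classes. -/
noncomputable def syzygyHom [HasFittingDecomposition C] : StableClass C →+ StableClass C :=
  let Ω : StableClass C → StableClass C := _root_.Quotient.map syzygy fun _ _ h ↦ h.syzygy
  have hΩ (a b : StableClass C) : Ω (a + b) = Ω a + Ω b := by
    induction a using ind
    induction b using ind
    exact mk_eq_mk_iff.2 (stablyIso_syzygy_biprod _ _)
  { toFun := Ω
    map_add' := hΩ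
    map_zero' := by
      have := hΩ 0 0
      rwa [add_zero, left_eq_add] at this }

lemma iterate_syzygyHom_mk [HasFittingDecomposition C] (X : C) (n : ℕ) :
    syzygyHom^[n] (mk X) = mk (syzygy^[n] X) := by
  induction n generalizing X with
  | zero => rfl
  | succ n ih => exact ih (syzygy X)

end StableClass

open WakamatsuSilting in
/-- The Igusa–Todorov bound: the finite projective dimensions of cokernels of monomorphisms
between objects of `add V` are bounded. -/
theorem exists_hasProjectiveDimensionLT_of_addClosure [HasFittingDecomposition C]
    [HasFiniteBiproducts C] (V : C) :
    ∃ N : ℕ, ∀ S : ShortComplex C, S.ShortExact → addClosure V S.X₁ → addClosure V S.X₂ →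
      (∃ m, HasProjectiveDimensionLT S.X₃ m) → HasProjectiveDimensionLT S.X₃ N := by
  let := HasExt.standard C
  obtain ⟨F, hF, hFV⟩ := exists_finite_local_retracts V
  have hcl {X : C} (hX : addClosure V X) :
      StableClass.mk X ∈ AddSubmonoid.closure (StableClass.mk '' F) := by
    let P : ObjectProperty C :=
      fun X ↦ StableClass.mk X ∈ AddSubmonoid.closure (StableClass.mk '' F)
    have : P.IsClosedUnderIsomorphisms := ⟨fun {X Y} e (h : _ ∈ _) ↦ by
      rwa [StableClass.mk_eq_mk_iff.2 (.of_iso e)] at h⟩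
    refine addClosure_induction P (fun X hX ↦ ?_) (fun W hW hr ↦ ?_) (fun X Y hX hY ↦ ?_) hX
    · change _ ∈ _
      rw [StableClass.mk_eq_zero hX]
      exact zero_mem _
    · obtain ⟨U, hU, ⟨e⟩⟩ := hFV W hW hr
      change _ ∈ _
      rw [StableClass.mk_eq_mk_iff.2 (.of_iso e)]
      exact AddSubmonoid.subset_closure ⟨U, hU, rfl⟩
    · change _ ∈ _
      rw [StableClass.mk_biprod]
      exact add_mem hX hY
  obtain ⟨n, hn⟩ := (StableClass.syzygyHom (C := C)).exists_iterate_eq_of_finite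
    (hF.image StableClass.mk)
  -- The finite list `G'` of possible nonprojective indecomposable summands of `n`-th syzygies
  -- depends only on `V`, because `n` and `F` do; hence so does `q` below.
  choose G hG hGW using fun U : C ↦ exists_finite_local_retracts (syzygy^[n] U)
  let G' : Set C := ⋃ U ∈ F, G U
  have hG' : G'.Finite := hF.biUnion fun U _ ↦ hG U
  have hgood {X : C} (hX : addClosure V X) : LocalRetractsIn G' (syzygy^[n] X) := by
    let P : ObjectProperty C := fun X ↦ LocalRetractsIn G' (syzygy^[n] X)
    have : P.IsClosedUnderIsomorphisms := ⟨fun {X Y} e h ↦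
      LocalRetractsIn.of_stablyIso ((StablyIso.of_iso e.symm).iterate_syzygy n) h⟩
    refine addClosure_induction P (fun X hX ↦ ?_) (fun W hW hr ↦ ?_)
      (fun X Y hX hY ↦ (hX.biprod hY).of_stablyIso (stablyIso_iterate_syzygy_biprod X Y n)) hX
    · have h₀ : StablyIso (syzygy^[n] X) 0 := by
        rw [← StableClass.mk_eq_mk_iff, ← StableClass.iterate_syzygyHom_mk,
          StableClass.mk_eq_zero hX, iterate_map_zero]
        rfl
      refine LocalRetractsIn.of_stablyIso h₀ fun W hW ⟨r⟩ ↦ (hW.not_isZero ?_).elim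
      rw [IsZero.iff_id_eq_zero, ← r.retract, (isZero_zero C).eq_of_tgt r.i 0, zero_comp]
    · obtain ⟨U, hU, ⟨e⟩⟩ := hFV W hW hr
      refine LocalRetractsIn.of_stablyIso ((StablyIso.of_iso e).iterate_syzygy n)
        fun W' hW' hr' ↦ .inr ?_
      obtain ⟨U', hU', e'⟩ := hGW U W' hW' hr'
      exact ⟨U', Set.mem_biUnion hU hU', e'⟩
  obtain ⟨q, hq⟩ : ∃ q : ℕ, ∀ U ∈ G', (∃ m, HasProjectiveDimensionLT U m) →
      HasProjectiveDimensionLT U (q + 1) := by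
    choose! d hd using fun (U : C) (h : ∃ m, HasProjectiveDimensionLT U m) ↦ h
    obtain ⟨q, hq⟩ := (hG'.image d).bddAbove
    refine ⟨q, fun U hU hU' ↦ ?_⟩
    have := hd U hU'
    have hle : d U ≤ q := hq ⟨U, hU, rfl⟩
    exact hasProjectiveDimensionLT_of_ge U (d U) (q + 1) (by lia)
  refine ⟨q + n + 2, fun S hS h₁ h₂ ⟨m, hm⟩ ↦ hS.hasProjectiveDimensionLT_of_extIso_f ?_⟩
  have hm' : HasProjectiveDimensionLT S.X₃ (m + n + 1) :=
    hasProjectiveDimensionLT_of_ge S.X₃ m _ (by lia)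
  have hf : ExtIso (m + n) S.f := hS.extIso_f (m + n)
  -- The stable isomorphism of `(m + n)`-th syzygies descends to the uniform level `n`, although `m`
  -- varies with the sequence.
  have hst : StablyIso (syzygy^[n] S.X₂) (syzygy^[n] S.X₁) := by
    obtain ⟨f', hf'⟩ := exists_iterate_syzygy_hom S.f (m + n)
    have h := ((hf' 0).2 (by rwa [zero_add])).stablyIso
    rw [← StableClass.mk_eq_mk_iff, ← StableClass.iterate_syzygyHom_mk,
      ← StableClass.iterate_syzygyHom_mk] at h ⊢
    exact (hn _ (hcl h₁) _ (hcl h₂) _ h).symm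
  obtain ⟨f', hf'⟩ := exists_iterate_syzygy_hom S.f n
  obtain ⟨s, hs⟩ := hst.exists_extIso
  rw [← hf']
  -- Composing with the stable isomorphism `s` turns `f'` into an endomorphism, to which Fitting's
  -- lemma applies; it remains to lower its threshold from `m` to `q`.
  refine ExtIso.of_comp_right (hs.mono (Nat.zero_le q)) ?_
  have hg : ExtIso m (f' ≫ s) := ((hf' m).2 hf).comp (hs.mono (Nat.zero_le m))
  obtain ⟨Y, Z, e, u, z, hu, hz, h⟩ := HasFittingDecomposition.fitting (f' ≫ s)
  have huz : ExtIso m (biprod.map u z) := by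
    rw [h] at hg
    exact (ExtIso.of_isIso e.inv m).of_comp_right ((ExtIso.of_isIso e.hom m).of_comp_left hg)
  have hZ : HasProjectiveDimensionLT Z (m + 1) :=
    huz.biprod_snd.hasProjectiveDimensionLT_of_isNilpotent hz
  -- Finiteness of the projective dimension of `Z`, known from `m`, upgrades to the uniform bound
  -- because its nonprojective indecomposable summands occur in `G'`.
  have hZ' : HasProjectiveDimensionLT Z (q + 1) := by
    refine hasProjectiveDimensionLT_of_local_retracts Z (q + 1) fun W hW ⟨r⟩ ↦ ?_
    have r' : Retract W (syzygy^[n] S.X₁) :=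
      (r.trans ⟨biprod.inr, biprod.snd, biprod.inr_snd⟩).trans e.symm.retract
    rcases hgood h₁ W hW ⟨r'⟩ with hW' | ⟨U, hU, ⟨e'⟩⟩
    · exact hasProjectiveDimensionLT_of_ge W 1 _ (by lia)
    · have := r.hasProjectiveDimensionLT (m + 1)
      have := hq U hU ⟨m + 1, hasProjectiveDimensionLT_of_iso e' (m + 1)⟩
      exact hasProjectiveDimensionLT_of_iso e'.symm (q + 1)
  rw [h]
  exact (ExtIso.of_isIso e.hom q).comp (((ExtIso.of_isIso u q).biprod_map
    (ExtIso.of_hasProjectiveDimensionLT z q)).comp (ExtIso.of_isIso e.inv q))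

end CategoryTheory

/-! ### Fitting and Krull–Schmidt for modules of finite length -/

namespace CategoryTheory

variable {C : Type u} [Category.{v} C] [Abelian C]

/-- An abelian category with Fitting decompositions and a length function strictly monotone on
proper direct summands is Krull–Schmidt. -/
lemma HasFittingDecomposition.of_length (ℓ : C → ℕ∞) (hℓ : ∀ {X Y : C}, (X ≅ Y) → ℓ X = ℓ Y)
    (hℓ' : ∀ X Y : C, ¬ IsZero X → ℓ Y < ℓ (X ⊞ Y))
    (fitting : ∀ {X : C} (f : X ⟶ X), ∃ (Y Z : C) (e : X ≅ Y ⊞ Z) (u : Y ⟶ Y) (z : Z ⟶ Z),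
      IsIso u ∧ IsNilpotent (End.of z) ∧ f = e.hom ≫ biprod.map u z ≫ e.inv) :
    HasFittingDecomposition C where
  fitting := fitting
  induction_local P _ zero local_end biprod_mem X := by
    induction hX : ℓ X using WellFoundedLT.induction generalizing X with
    | ind a ih =>
    subst hX
    by_cases hX₀ : IsZero X
    · exact zero X hX₀
    by_cases hX : ∀ f : X ⟶ X, IsIso f ∨ IsIso (𝟙 X - f)
    · exact local_end X ⟨hX₀, hX⟩
    push Not at hX
    obtain ⟨f, hf, hf'⟩ := hX
    -- Both summands are nonzero: `Z = 0` would make `f` invertible, and `Y = 0` would make it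
    -- nilpotent, hence `𝟙 X - f` invertible. So both have smaller length.
    obtain ⟨Y, Z, e, u, z, hu, hz, rfl⟩ := fitting f
    refine P.prop_of_iso e.symm (biprod_mem Y Z (ih (ℓ Y) ?_ Y rfl) (ih (ℓ Z) ?_ Z rfl))
    · rw [hℓ (e ≪≫ biprod.braiding Y Z)]
      refine hℓ' Z Y fun hZ ↦ hf ?_
      have : IsIso z := ⟨0, hZ.eq_of_src _ _, hZ.eq_of_src _ _⟩
      have : IsIso (biprod.map u z) := (biprod.mapIso (asIso u) (asIso z)).isIso_hom
      infer_instance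
    · rw [hℓ e]
      refine hℓ' Y Z fun hY ↦ hf' ?_
      have : IsIso (𝟙 Z - z) := (isUnit_iff_isIso (C := C) _).1 hz.isUnit_one_sub
      have : IsIso (𝟙 Y - u) := ⟨0, hY.eq_of_src _ _, hY.eq_of_src _ _⟩
      have h : 𝟙 X - e.hom ≫ biprod.map u z ≫ e.inv =
          e.hom ≫ biprod.map (𝟙 Y - u) (𝟙 Z - z) ≫ e.inv := by
        have : biprod.map (𝟙 Y - u) (𝟙 Z - z) = 𝟙 (Y ⊞ Z) - biprod.map u z := by
          ext <;> simp
        rw [this]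
        simp
      rw [h]
      have : IsIso (biprod.map (𝟙 Y - u) (𝟙 Z - z)) :=
        (biprod.mapIso (asIso (𝟙 Y - u)) (asIso (𝟙 Z - z))).isIso_hom
      infer_instance

end CategoryTheory

namespace FGModuleCat

lemma isZero_iff_subsingleton {R : Type u} [Ring R] [IsNoetherianRing R] (M : FGModuleCat.{u} R) :
    IsZero M ↔ Subsingleton M := by
  rw [IsZero.iff_id_eq_zero]
  refine ⟨fun h ↦ ⟨fun x y ↦ ?_⟩, fun h ↦ by ext x; exact Subsingleton.elim _ _⟩
  have h' (x : M) : x = 0 := congrArg (fun f : M ⟶ M ↦ f.hom.hom x) h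
  rw [h' x, h' y]

lemma length_biprod {R : Type u} [Ring R] [IsNoetherianRing R] (X Y : FGModuleCat.{u} R) :
    Module.length R (X ⊞ Y : FGModuleCat.{u} R) = Module.length R X + Module.length R Y := by
  rw [← Module.length_prod]
  exact (isoToLinearEquiv (isoBiprodOfProdEquiv (M := of R (X × Y))
    (LinearEquiv.refl R (X × Y)))).length_eq.symm

variable {R : Type u} [Ring R] [IsNoetherianRing R] [IsArtinianRing R]

/-- Fitting's lemma. -/
lemma fitting {X : FGModuleCat.{u} R} (f : X ⟶ X) :
    ∃ (Y Z : FGModuleCat.{u} R) (e : X ≅ Y ⊞ Z) (u : Y ⟶ Y) (z : Z ⟶ Z),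
      IsIso u ∧ IsNilpotent (End.of z) ∧ f = e.hom ≫ biprod.map u z ≫ e.inv := by
  let φ : Module.End R X := f.hom.hom
  -- Positivity of `n` puts the kernel of `φ` inside that of `φ ^ n`, which gives injectivity of
  -- `u`.
  obtain ⟨n, hn, hn₀⟩ :=
    (φ.eventually_isCompl_ker_pow_range_pow.and (Filter.eventually_gt_atTop 0)).exists
  let p := LinearMap.range (φ ^ n)
  let q := LinearMap.ker (φ ^ n)
  have hcomm (x : X) : φ ((φ ^ n) x) = (φ ^ n) (φ x) := by
    rw [← Module.End.mul_apply, ← Module.End.mul_apply, (Commute.self_pow φ n).eq]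
  have hp : ∀ x ∈ p, φ x ∈ p := by
    rintro _ ⟨x, rfl⟩
    exact ⟨φ x, (hcomm x).symm⟩
  have hq : ∀ x ∈ q, φ x ∈ q := fun x (hx : (φ ^ n) x = 0) ↦ by
    change (φ ^ n) (φ x) = 0
    rw [← hcomm, hx, map_zero]
  let u : p →ₗ[R] p := φ.restrict hp
  let z : q →ₗ[R] q := φ.restrict hq
  let E := (Submodule.prodEquivOfIsCompl p q hn.symm).symm
  let e : X ≅ of R p ⊞ of R q := isoBiprodOfProdEquiv (A := of R p) (B := of R q) E
  have hu : Function.Bijective u := by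
    refine IsArtinian.bijective_of_injective_endomorphism u ?_
    rw [← LinearMap.ker_eq_bot, LinearMap.ker_eq_bot']
    rintro ⟨x, hx⟩ hx'
    have h₀ : φ x = 0 := congrArg Subtype.val hx'
    have h₁ : x ∈ q := by
      obtain ⟨m, rfl⟩ := Nat.exists_eq_succ_of_ne_zero hn₀.ne'
      change (φ ^ (m + 1)) x = 0
      rw [pow_succ, Module.End.mul_apply, h₀, map_zero]
    exact Subtype.ext (Submodule.disjoint_def.1 hn.disjoint x h₁ hx)
  have hz : z ^ n = 0 := by
    ext ⟨x, hx⟩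
    rw [Module.End.pow_restrict]
    exact hx
  refine ⟨of R p, of R q, e, ofHom u, ofHom z, (LinearEquiv.ofBijective u hu).toFGModuleCatIso.isIso_hom,
    ⟨n, ?_⟩, ?_⟩
  · have hpow (k : ℕ) : (End.of (ofHom z) ^ k : End (of R q)) = End.of (ofHom (z ^ k)) := by
      induction k with
      | zero => rfl
      | succ k ih => rw [pow_succ, ih]; rfl
    rw [hpow, hz]
    rfl
  · have hl : biprod.inl ≫ e.inv = ofHom p.subtype := (biprod.inl_desc _ _).trans (by
      ext x
      exact add_zero (x : X))
    have hr : biprod.inr ≫ e.inv = ofHom q.subtype := (biprod.inr_desc _ _).trans (by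
      ext x
      exact zero_add (x : X))
    rw [← Iso.inv_comp_eq]
    apply biprod.hom_ext'
    · rw [reassoc_of% hl, biprod.inl_map_assoc, hl]
      rfl
    · rw [reassoc_of% hr, biprod.inr_map_assoc, hr]
      rfl

instance hasFittingDecomposition : HasFittingDecomposition (FGModuleCat.{u} R) := by
  refine .of_length (fun X ↦ Module.length R X) (fun e ↦ (isoToLinearEquiv e).length_eq)
    (fun X Y hX ↦ ?_) fitting
  rw [length_biprod]
  have : Module.length R Y ≠ ⊤ := Module.length_ne_top
  have hX' : 0 < Module.length R X := by
    rw [pos_iff_ne_zero, Ne, Module.length_eq_zero_iff, ← isZero_iff_subsingleton]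
    exact hX
  exact ENat.lt_add_left this hX'

end FGModuleCat

instance IsArtinAlgebra.isArtinianRing (R : Type u) [Ring R] [h : IsArtinAlgebra R] :
    IsArtinianRing R := by
  obtain ⟨k, _, _, _, _⟩ := h.exists_base
  exact isArtinian_of_tower k inferInstance

/-! ### Igusa–Todorov algebras -/

namespace WakamatsuSilting

variable {R : Type u} [Ring R] [IsNoetherianRing R]

lemma IsSyzygy.hasProjectiveDimensionLT_iff {n : ℕ} {M K : FGModuleCat.{u} R}
    (h : IsSyzygy R n M K) (m : ℕ) :
    HasProjectiveDimensionLT M (m + 1 + n) ↔ HasProjectiveDimensionLT K (m + 1) := by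
  induction n generalizing M with
  | zero =>
    obtain ⟨e⟩ := h
    exact ⟨fun _ ↦ hasProjectiveDimensionLT_of_iso e.symm _,
      fun _ ↦ hasProjectiveDimensionLT_of_iso e _⟩
  | succ n ih =>
    obtain ⟨S, hS, hP, ⟨e⟩, h⟩ := h
    rw [← ih h]
    have := hS.hasProjectiveDimensionLT_X₃_iff (m + n) ((FGModuleCat.projective_iff _).2 hP)
    rw [show m + 1 + n = m + n + 1 by lia, ← this, show m + 1 + (n + 1) = m + n + 2 by lia]
    exact ⟨fun _ ↦ hasProjectiveDimensionLT_of_iso e.symm _,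
      fun _ ↦ hasProjectiveDimensionLT_of_iso e _⟩

/-- Igusa–Todorov algebras satisfy the finitistic dimension conjecture. -/
theorem IsIgusaTodorov.finitisticDimensionConjecture [IsArtinianRing R] (h : IsIgusaTodorov R) :
    FinitisticDimensionConjecture R := by
  obtain ⟨n, V, hV⟩ := h
  obtain ⟨N, hN⟩ := exists_hasProjectiveDimensionLT_of_addClosure V
  rw [finitisticDimensionConjecture_iff]
  refine ⟨N + n, fun M ⟨m, hm⟩ ↦ ?_⟩
  obtain ⟨K, P, S, hK, hP, hS, h₁, h₂, ⟨e⟩⟩ := hV M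
  have hM : HasProjectiveDimensionLT M (m + 1 + n) := hasProjectiveDimensionLT_of_ge M m _ (by lia)
  have hKm : HasProjectiveDimensionLT K (m + 1) := (hK.hasProjectiveDimensionLT_iff m).1 hM
  have := (FGModuleCat.projective_iff P).2 hP
  have hPm : HasProjectiveDimensionLT P (m + 1) := hasProjectiveDimensionLT_of_ge P 1 _ (by lia)
  have hX₃ := hN S hS h₁ h₂ ⟨m + 1, hasProjectiveDimensionLT_of_iso e.symm (m + 1)⟩
  -- Shifting back from `K` to `M` needs a positive bound, since a zero syzygy is no better than a
  -- projective one.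
  have hX₃' : HasProjectiveDimensionLT S.X₃ (N + 1) := hasProjectiveDimensionLT_of_ge _ N _ (by lia)
  have r : Retract K S.X₃ := .trans ⟨biprod.inl, biprod.fst, biprod.inl_fst⟩ e.symm.retract
  have hKN := (hK.hasProjectiveDimensionLT_iff N).2 (r.hasProjectiveDimensionLT (N + 1))
  rwa [show N + n + 1 = N + 1 + n by lia]

end WakamatsuSilting

theorem theorem3p7 (R : Type u) [Ring R] [IsArtinAlgebra R]
    [HasDerivedCategory.{w} (FGModuleCat.{u} R)] :
    -- the two families of examples satisfy the finitistic dimension conjecture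
    (injectiveDimension (ModuleCat.of R R) ≠ ⊤ →
      WakamatsuSilting.FinitisticDimensionConjecture R) ∧
    (WakamatsuSilting.IsIgusaTodorov R →
      WakamatsuSilting.FinitisticDimensionConjecture R) ∧
    -- under the conjecture, compact Wakamatsu-silting complexes are silting
    (WakamatsuSilting.FinitisticDimensionConjecture R →
      ∀ T : DerivedCategory (FGModuleCat.{u} R),
        WakamatsuSilting.perfect R T → WakamatsuSilting.IsWakamatsuSilting T →
          WakamatsuSilting.IsSilting T) := by
  exact ⟨WakamatsuSilting.finitisticDimensionConjecture_of_injectiveDimension_ne_top R,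
    WakamatsuSilting.IsIgusaTodorov.finitisticDimensionConjecture,
    WakamatsuSilting.isSilting_of_isWakamatsuSilting⟩
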